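/- Let $r$ and $m$ be integers with $1\le r\le 23$, $(r,6)=1$, and $m\ge 0$ even. Let $M_m(1)$ be the space of modular forms of weight $m$ for $\mathrm{SL}_2(\mathbb Z)$, let $\eta(\tau)=q^{1/24}\prod_{n\ge1}(1-q^n)$, $q=e^{2\pi i\tau}$, be the Dedekind eta function, and let $\chi_{12}$ be the Dirichlet character with $\chi_{12}(n)=1$ if $n\equiv\pm1\pmod{12}$, $\chi_{12}(n)=-1$ if $n\equiv\pm5\pmod{12}$, and $\chi_{12}(n)=0$ otherwise. Put $k=m+\tfrac{r-1}{2}$, so that $k+\tfrac12=\tfrac r2+m$, and let $S_{k+\frac12}(576,\chi_{12})$ be the space of cusp forms of weight $k+\tfrac12$ and character $\chi_{12}$ for $\Gamma_0(576)$ in the sense of Shimura, that is, of the holomorphic functions $f$ on the upper half plane that satisfy $$f\left(\frac{a\tau+b}{c\tau+d}\right)=\chi_{12}(d)\left(\frac{\theta\left(\frac{a\tau+b}{c\tau+d}\right)}{\theta(\tau)}\right)^{2k+1}f(\tau),\qquad \theta(\tau)=\sum_{n\in\mathbb Z}q^{n^2},$$ for all $\begin{pmatrix}a&b\\c&d\end{pmatrix}\in\Gamma_0(576)$,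 and vanish at all cusps. For a prime $\ell>3$ and $f=\sum_{n\ge0}a(n)q^n$ in this space, put $f\mid T(\ell^2)=\sum_{n\ge0}c(n)q^n$, where $$c(n)=a(\ell^2n)+\chi_{12}(\ell)\left(\frac{(-1)^kn}{\ell}\right)\ell^{k-1}a(n)+\chi_{12}(\ell^2)\,\ell^{2k-1}a(n/\ell^2),$$ $\left(\frac{\cdot}{\ell}\right)$ is the Legendre symbol, and $a(x)=0$ if $x$ is not a nonnegative integer. If $\dim M_m(1)=1$ and $0\ne F\in M_m(1)$, then $g(\tau)=\eta^r(24\tau)F(24\tau)$ is a Hecke eigenform in $S_{\frac r2+m}(576,\chi_{12})$: the function $g$ is a nonzero element of this space, and for every prime $\ell>3$ there is a $\lambda_\ell\in\mathbb C$ such that $g\mid T(\ell^2)=\lambda_\ell\, g$. -/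

import Mathlib

open UpperHalfPlane ModularForm
open scoped MatrixGroups Manifold

noncomputable section

namespace HalfIntegral

/-- The point `d τ` of the upper half plane, for a positive integer `d`. -/
def dilate (d : ℕ) [NeZero d] (τ : ℍ) : ℍ :=
  ⟨(d : ℂ) * (τ : ℂ), by
    have hd : (0 : ℝ) < d := Nat.cast_pos.mpr (Nat.pos_of_ne_zero (NeZero.ne d))
    simpa using mul_pos hd τ.im_pos⟩

/-- The integer-valued character `χ₁₂` modulo `12`. -/
def chiTwelveInt : MulChar (ZMod 12) ℤ where
  toFun a := if a = 1 ∨ a = -1 then 1 else if a = 5 ∨ a = -5 then -1 else 0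
  map_one' := by decide
  map_mul' := by decide
  map_nonunit' := by decide

/-- `χ₁₂` as a complex Dirichlet character modulo `12`. -/
def chiTwelve : DirichletCharacter ℂ 12 :=
  chiTwelveInt.ringHomComp (Int.castRingHom ℂ)

/-- `χ₁₂` as a Dirichlet character modulo `576`. -/
def chiTwelve576 : DirichletCharacter ℂ 576 :=
  DirichletCharacter.changeLevel (by norm_num : 12 ∣ 576) chiTwelve

/-- Shimura's theta function `θ(τ) = ∑_{n ∈ ℤ} exp(2πi n² τ)`; Mathlib's `jacobiTheta` is
`∑_{n ∈ ℤ} exp(πi n² τ)`. -/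
def theta (τ : ℍ) : ℂ := jacobiTheta (2 * (τ : ℂ))

/-- Shimura's automorphy factor `j(γ, τ) = θ(γτ) / θ(τ)`, of weight `1/2`, for `γ ∈ Γ₀(4)`
(`θ` has no zeros in the upper half plane). -/
def thetaFactor (γ : SL(2, ℤ)) (τ : ℍ) : ℂ := theta (γ • τ) / theta τ

/-- `(α, φ)` is an element of Shimura's group `G` lying over `α ∈ SL₂(ℤ)`: the function `φ` is
holomorphic and `φ(τ)² = s (cτ + d)` with a constant `s` of absolute value `1`, where `(c d)` is
the last row of `α`. -/
def IsShimuraPair (α : SL(2, ℤ)) (φ : ℍ → ℂ) : Prop :=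
  MDifferentiable 𝓘(ℂ) 𝓘(ℂ) φ ∧
    ∃ s : ℂ, ‖s‖ = 1 ∧ ∀ τ : ℍ, φ τ ^ 2 = s * ((α 1 0 : ℂ) * (τ : ℂ) + (α 1 1 : ℂ))

/-- The slash operator of weight `k + 1/2`: `(f | (α, φ))(τ) = φ(τ)^(-2k-1) f(ατ)`. -/
def halfSlash (k : ℕ) (f : ℍ → ℂ) (α : SL(2, ℤ)) (φ : ℍ → ℂ) (τ : ℍ) : ℂ :=
  (φ τ ^ (2 * k + 1))⁻¹ * f (α • τ)

/-- `f ∈ S_{k+1/2}(N, χ)`, for `4 ∣ N`, in the sense of Shimura: `f` is holomorphic on the upper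
half plane, `f(γτ) = χ(d) j(γ, τ)^(2k+1) f(τ)` for all `γ ∈ Γ₀(N)` with lower right entry `d`,
and `f` vanishes at every cusp `α(∞)`, `α ∈ SL₂(ℤ)`. -/
structure IsCuspForm (k N : ℕ) (χ : DirichletCharacter ℂ N) (f : ℍ → ℂ) : Prop where
  holo : MDifferentiable 𝓘(ℂ) 𝓘(ℂ) f
  transform : ∀ γ ∈ CongruenceSubgroup.Gamma0 N, ∀ τ : ℍ,
    f (γ • τ) = χ ((γ 1 1 : ℤ) : ZMod N) * thetaFactor γ τ ^ (2 * k + 1) * f τ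
  zero_at_cusps : ∀ (α : SL(2, ℤ)) (φ : ℍ → ℂ), IsShimuraPair α φ →
    IsZeroAtImInfty (halfSlash k f α φ)

/-- The action of the Hecke operator `T(ℓ²)` of weight `k + 1/2` and character `χ` on Fourier
coefficients:
`c(n) = a(ℓ² n) + χ(ℓ) ((-1)^k n / ℓ) ℓ^(k-1) a(n) + χ(ℓ²) ℓ^(2k-1) a(n / ℓ²)`,
where `a(n / ℓ²) = 0` unless `ℓ² ∣ n`. -/
def heckeCoeff (k : ℕ) {N : ℕ} (χ : DirichletCharacter ℂ N) (ℓ : ℕ) [Fact ℓ.Prime]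
    (a : ℕ → ℂ) (n : ℕ) : ℂ :=
  a (ℓ ^ 2 * n)
    + χ (ℓ : ZMod N) * (legendreSym ℓ ((-1) ^ k * (n : ℤ)) : ℂ) * (ℓ : ℂ) ^ ((k : ℤ) - 1) * a n
    + χ ((ℓ ^ 2 : ℕ) : ZMod N) * (ℓ : ℂ) ^ (2 * (k : ℤ) - 1) *
        (if ℓ ^ 2 ∣ n then a (n / ℓ ^ 2) else 0)

/-- The `n`-th term `c(n) q^n`, `q = exp(2πiτ)`, of the Fourier series of `f | T(ℓ²)`. -/
def heckeTerm (k : ℕ) {N : ℕ} (χ : DirichletCharacter ℂ N) (ℓ : ℕ) [Fact ℓ.Prime]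
    (f : ℍ → ℂ) (τ : ℍ) (n : ℕ) : ℂ :=
  heckeCoeff k χ ℓ (fun j => (qExpansion 1 f).coeff j) n * Function.Periodic.qParam 1 (τ : ℂ) ^ n

/-- The Hecke operator `f ↦ f | T(ℓ²)` of weight `k + 1/2` and character `χ`. -/
def heckeT (k : ℕ) {N : ℕ} (χ : DirichletCharacter ℂ N) (ℓ : ℕ) [Fact ℓ.Prime]
    (f : ℍ → ℂ) (τ : ℍ) : ℂ :=
  ∑' n : ℕ, heckeTerm k χ ℓ f τ n

/-- The function `τ ↦ η(24τ)^r F(24τ)`. -/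
def etaTwist (r : ℕ) (F : ℍ → ℂ) (τ : ℍ) : ℂ :=
  eta (24 * (τ : ℂ)) ^ r * F (dilate 24 τ)

end HalfIntegral

end

/-! Everything rests on one inversion formula. Poisson summation, applied near a rational point `b /
d` to a theta series with coefficients of period `N` prime to `d`, yields the quadratic Gauss sum of
`b` modulo `d` times the theta series of the Fourier transform of the coefficients
(`thetaSeries_inversion`). Shimura's θ has constant coefficients; by the pentagonal number theorem η
has the coefficients χ₁₂, which up to `√12` is its own Fourier transform. Both series therefore
produce the same Gauss sum, and η(24γτ) = χ₁₂(d) j(γ, τ) η(24τ) on Γ₀(576) follows without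
evaluating it (`eta_smul`). As `m` is even, the factor (cτ + d)^m of F(24τ) is j^(2m), for which j⁴
= (cτ + d)² suffices (`thetaFactor_pow_four`). Vanishing at the cusps is read off from the 24th
power of the absolute value, where η^r becomes Δ^r.

For the Hecke operator put z = 24τ and f = η^r F. Then f | T(ℓ²) is a finite combination of values
f((z + 24b)/D) with D = ℓ, ℓ² and of f at rescaled arguments. The map z ↦ -1/z exchanges f(z/ℓ²)
with f(ℓ²z), exchanges the sum over nonzero b modulo ℓ with its twist by the Legendre symbol, and
permutes the translates by units modulo ℓ². The coefficients of T(ℓ²) are the ones for which the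
total transforms as f does (`EtaInversion.heckeSum_neg_inv`). Since ℓ² ≡ 1 modulo 24, the exponents
of f | T(ℓ²) remain ≡ r modulo 24, and r < 24 makes the quotient by η^r bounded at i∞. Hence f |
T(ℓ²) = η^r G with G of level one and weight `m` (`exists_modularForm_of_inversion`), and G lies on
the line spanned by F. -/

open scoped Real

noncomputable section

namespace HalfIntegral


/-! ### Poisson summation for theta series with periodic coefficients -/

section Poisson

/-- The theta series `∑ f(n) exp(2πi n² w)` attached to a function of period `N`. -/
def thetaSeries {N : ℕ} (f : ZMod N → ℂ) (w : ℂ) : ℂ :=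
  ∑' n : ℤ, f n * Complex.exp (2 * π * Complex.I * (n : ℂ) ^ 2 * w)

lemma summable_cexp_sq {w : ℂ} (hw : 0 < w.im) :
    Summable fun n : ℤ ↦ ‖Complex.exp (2 * π * Complex.I * (n : ℂ) ^ 2 * w)‖ := by
  have h : 0 < (2 * w).im := by simpa using hw
  refine ((summable_jacobiTheta₂_term_iff 0 (2 * w)).mpr h).norm.congr fun n ↦ ?_
  rw [jacobiTheta₂_term]
  congr 2
  ring

lemma summable_mul_cexp_sq {w : ℂ} (hw : 0 < w.im) {N : ℕ} [NeZero N] (f : ZMod N → ℂ) :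
    Summable fun n : ℤ ↦ f n * Complex.exp (2 * π * Complex.I * (n : ℂ) ^ 2 * w) := by
  refine .of_norm_bounded ((summable_cexp_sq hw).mul_left (∑ x, ‖f x‖)) fun n ↦ ?_
  rw [norm_mul]
  gcongr
  exact Finset.single_le_sum (f := fun x ↦ ‖f x‖) (fun _ _ ↦ norm_nonneg _) (Finset.mem_univ _)

lemma eq_inv_mul_sum_stdAddChar_mul_dft {N : ℕ} [NeZero N] (f : ZMod N → ℂ) (x : ZMod N) :
    f x = (N : ℂ)⁻¹ * ∑ j, ZMod.stdAddChar (j * x) * ZMod.dft f j := by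
  have := congrFun (ZMod.dft.symm_apply_apply f) x
  rw [ZMod.invDFT_apply] at this
  simpa [mul_comm] using this.symm

lemma stdAddChar_fin_mul_intCast {N : ℕ} [NeZero N] (j : Fin N) (n : ℤ) :
    ZMod.stdAddChar (((j : ℕ) : ZMod N) * (n : ZMod N)) =
      Complex.exp (2 * π * Complex.I * n * ((j : ℂ) / N)) := by
  have := ZMod.stdAddChar_coe (N := N) ((j : ℕ) * n)
  push_cast at this
  rw [this]
  congr 1
  ring

lemma sum_zmod_eq_sum_fin {N : ℕ} [NeZero N] (F : ZMod N → ℂ) :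
    ∑ j, F j = ∑ j : Fin N, F ((j : ℕ) : ZMod N) := by
  rw [← Equiv.sum_comp (ZMod.finEquiv N).toEquiv F]
  refine Finset.sum_congr rfl fun j _ ↦ ?_
  congr 1
  obtain _ | N := N
  · exact j.elim0
  · exact (Fin.cast_val_eq_self j).symm

lemma tsum_int_eq_sum_fin (N : ℕ) [NeZero N] {F : ℤ → ℂ} (hF : Summable F) :
    ∑' n, F n = ∑ j : Fin N, ∑' m : ℤ, F (m * N + (j : ℕ)) := by
  let e := (Equiv.prodComm (Fin N) ℤ).trans (Int.divModEquiv N).symm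
  rw [← e.tsum_eq]
  refine (Summable.tsum_prod (e.summable_iff.mpr hF)).trans ?_
  rw [tsum_fintype]
  rfl

/-- Poisson summation for theta series with periodic coefficients. -/
theorem thetaSeries_eq_tsum_dft {N : ℕ} [NeZero N] (f : ZMod N → ℂ) {w : ℂ} (hw : 0 < w.im) :
    thetaSeries f w = 1 / (-Complex.I * (2 * w)) ^ (1 / 2 : ℂ) * ((N : ℂ)⁻¹ *
      thetaSeries (ZMod.dft f) (-1 / (4 * (N : ℂ) ^ 2 * w))) := by
  have hN : (N : ℂ) ≠ 0 := NeZero.ne _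
  have hw0 : w ≠ 0 := by rintro rfl; simp at hw
  have h2w : 0 < (2 * w).im := by simpa using hw
  have hw' : 0 < (-1 / (4 * (N : ℂ) ^ 2 * w)).im := by
    have : (-1 / (4 * (N : ℂ) ^ 2 * w)) = ((1 / (4 * (N : ℝ) ^ 2) : ℝ) : ℂ) * (-w)⁻¹ := by
      push_cast; field_simp
    rw [this, Complex.re_ofReal_mul |> fun _ ↦ Complex.im_ofReal_mul]
    refine mul_pos (by have : (0 : ℝ) < N := Nat.cast_pos.mpr (NeZero.pos N); positivity) ?_
    rw [Complex.inv_im]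
    simpa using div_pos hw (Complex.normSq_pos.mpr hw0)
  -- Finite Fourier inversion expands `f` in additive characters, and each character shifts the
  -- elliptic variable of Jacobi's θ by `j / N`. The other side is split by residues modulo `N`; the
  -- functional equation of `jacobiTheta₂` then matches the two sums term by term.
  have hL : thetaSeries f w = (N : ℂ)⁻¹ * ∑ j : Fin N,
      ZMod.dft f ((j : ℕ) : ZMod N) * jacobiTheta₂ ((j : ℂ) / N) (2 * w) := by
    have : ∀ n : ℤ, f n * Complex.exp (2 * π * Complex.I * (n : ℂ) ^ 2 * w) = (N : ℂ)⁻¹ * ∑ j : Fin N,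
        ZMod.dft f ((j : ℕ) : ZMod N) * jacobiTheta₂_term n ((j : ℂ) / N) (2 * w) := by
      intro n
      rw [eq_inv_mul_sum_stdAddChar_mul_dft f n, sum_zmod_eq_sum_fin, mul_assoc, Finset.sum_mul]
      congr 1
      refine Finset.sum_congr rfl fun j _ ↦ ?_
      rw [stdAddChar_fin_mul_intCast, jacobiTheta₂_term, Complex.exp_add]
      ring_nf
    rw [thetaSeries, tsum_congr this, tsum_mul_left]
    congr 1
    rw [Summable.tsum_finsetSum fun j _ ↦
      ((summable_jacobiTheta₂_term_iff _ _).mpr h2w).mul_left _]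
    exact Finset.sum_congr rfl fun j _ ↦ tsum_mul_left
  have hR : thetaSeries (ZMod.dft f) (-1 / (4 * (N : ℂ) ^ 2 * w)) = ∑ j : Fin N,
      ZMod.dft f ((j : ℕ) : ZMod N) * (Complex.exp (-π * Complex.I * ((j : ℂ) / N) ^ 2 / (2 * w)) *
        jacobiTheta₂ ((j : ℂ) / N / (2 * w)) (-1 / (2 * w))) := by
    rw [thetaSeries, tsum_int_eq_sum_fin N (summable_mul_cexp_sq hw' (ZMod.dft f))]
    refine Finset.sum_congr rfl fun j _ ↦ ?_
    -- Replacing `m` by `-m` corrects the sign of the cross term of `(m + j / N)²`.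
    rw [← (Equiv.neg ℤ).tsum_eq, jacobiTheta₂, ← tsum_mul_left, ← tsum_mul_left]
    refine tsum_congr fun m ↦ ?_
    rw [Equiv.neg_apply, jacobiTheta₂_term]
    push_cast
    rw [ZMod.natCast_self, mul_zero, zero_add, ← Complex.exp_add]
    congr 2
    field_simp
    ring
  rw [hL, hR, mul_left_comm]
  congr 1
  rw [Finset.mul_sum]
  refine Finset.sum_congr rfl fun j _ ↦ ?_
  rw [jacobiTheta₂_functional_equation]
  ring

end Poisson

/-! ### Theta series near a rational point -/

section Inversion

/-- The quadratic Gauss sum `∑ exp(2πi b x² / d)` over `x` modulo `d`. -/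
def quadGauss (d : ℕ) [NeZero d] (b : ℤ) : ℂ :=
  ∑ x : ZMod d, ZMod.stdAddChar ((b : ZMod d) * x ^ 2)

/-- Since `(d v + N u) / (N d) = v / N + u / d`, the character modulo `N d` splits along the Chinese
remainder parametrisation of `bijective_mul_add_mul`. -/
lemma stdAddChar_mul_add_mul {N d : ℕ} [NeZero N] [NeZero d] (v u t : ℤ) :
    (ZMod.stdAddChar (N := N * d) (-((d * v + N * u : ℤ) * t : ZMod (N * d)))) =
      ZMod.stdAddChar (N := N) (-(v * t)) * ZMod.stdAddChar (N := d) (-(u * t)) := by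
  have h1 := ZMod.stdAddChar_coe (N := N * d) (-((d * v + N * u) * t))
  have h2 := ZMod.stdAddChar_coe (N := N) (-(v * t))
  have h3 := ZMod.stdAddChar_coe (N := d) (-(u * t))
  push_cast at h1 h2 h3 ⊢
  rw [h1, h2, h3, ← Complex.exp_add]
  congr 1
  have hN : (N : ℂ) ≠ 0 := NeZero.ne _
  have hd : (d : ℂ) ≠ 0 := NeZero.ne _
  field_simp
  ring

lemma bijective_mul_add_mul {N d : ℕ} [NeZero N] [NeZero d] (h : N.Coprime d) :
    Function.Bijective fun p : ZMod N × ZMod d ↦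
      ((d * (p.1.val : ℤ) + N * (p.2.val : ℤ) : ℤ) : ZMod (N * d)) := by
  rw [Fintype.bijective_iff_injective_and_card]
  refine ⟨fun p p' hp ↦ ?_, by simp [ZMod.card]⟩
  have h1 := congrArg (ZMod.castHom (Dvd.intro _ rfl : N ∣ N * d) (ZMod N)) hp
  have h2 := congrArg (ZMod.castHom (Dvd.intro_left _ rfl : d ∣ N * d) (ZMod d)) hp
  simp only [map_intCast] at h1 h2
  push_cast at h1 h2
  simp only [ZMod.natCast_self, ZMod.natCast_zmod_val, zero_mul, add_zero, zero_add] at h1 h2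
  have hu : IsUnit (d : ZMod N) := (ZMod.isUnit_iff_coprime d N).mpr h.symm
  have hu' : IsUnit (N : ZMod d) := (ZMod.isUnit_iff_coprime N d).mpr h
  exact Prod.ext (hu.mul_left_cancel h1) (hu'.mul_left_cancel h2)

/-- Completing the square: the shift of `u` by `2 b' t` absorbs the linear term exactly because `4
N² b b' = -1`, and leaves the phase `b' t²`. -/
lemma sum_stdAddChar_quadratic {N d : ℕ} [NeZero d] (h : N.Coprime d) {b b' : ℤ}
    (hb : (4 * (N : ZMod d) ^ 2 * (b : ZMod d) * (b' : ZMod d) : ZMod d) = -1) (t : ZMod d) :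
    ∑ u : ZMod d, ZMod.stdAddChar (-(u * t)) * ZMod.stdAddChar ((b : ZMod d) * ((N : ZMod d) * u) ^ 2) =
      quadGauss d b * ZMod.stdAddChar ((b' : ZMod d) * t ^ 2) := by
  have hu : IsUnit (N : ZMod d) := (ZMod.isUnit_iff_coprime N d).mpr h
  have key : ∀ u : ZMod d,
      ZMod.stdAddChar (-(u * t)) * ZMod.stdAddChar ((b : ZMod d) * ((N : ZMod d) * u) ^ 2) =
        ZMod.stdAddChar ((b : ZMod d) * ((N : ZMod d) * (u + 2 * (b' : ZMod d) * t)) ^ 2) *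
          ZMod.stdAddChar ((b' : ZMod d) * t ^ 2) := by
    intro u
    rw [← AddChar.map_add_eq_mul, ← AddChar.map_add_eq_mul]
    congr 1
    linear_combination (-(u * t) - b' * t ^ 2) * hb
  simp_rw [key]
  rw [← Finset.sum_mul, quadGauss]
  congr 1
  refine (Equiv.sum_comp (Equiv.addRight (2 * (b' : ZMod d) * t))
    (fun u ↦ ZMod.stdAddChar ((b : ZMod d) * ((N : ZMod d) * u) ^ 2))).trans ?_
  exact Equiv.sum_comp hu.unit.mulLeft (fun u ↦ ZMod.stdAddChar ((b : ZMod d) * u ^ 2))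

/-- The product of `f(n)`, of period `N`, and `exp(2πi b n² / d)`, of period `d`. -/
def quadTwist {N : ℕ} (f : ZMod N → ℂ) (d : ℕ) [NeZero d] (b : ℤ) (x : ZMod (N * d)) : ℂ :=
  f (ZMod.castHom (Dvd.intro _ rfl : N ∣ N * d) (ZMod N) x) *
    ZMod.stdAddChar ((b : ZMod d) *
      (ZMod.castHom (Dvd.intro_left _ rfl : d ∣ N * d) (ZMod d) x) ^ 2)

/-- Under `x = d v + N u` the transform factors into one modulo `N` and one modulo `d`. The dilation
by `d` inside `f` arises because `x ≡ d v` modulo `N`. A quadratic phase is transformed into a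
quadratic phase, which is again a translation of the argument of the theta series. -/
lemma dft_quadTwist {N d : ℕ} [NeZero N] [NeZero d] (h : N.Coprime d) (f : ZMod N → ℂ) {b b' : ℤ}
    (hb : (4 * (N : ZMod d) ^ 2 * (b : ZMod d) * (b' : ZMod d) : ZMod d) = -1) (t : ℤ) :
    ZMod.dft (quadTwist f d b) t = ZMod.dft (fun x ↦ f ((d : ZMod N) * x)) t *
      (quadGauss d b * ZMod.stdAddChar ((b' : ZMod d) * (t : ZMod d) ^ 2)) := by
  rw [← sum_stdAddChar_quadratic h hb, ZMod.dft_apply, ZMod.dft_apply, Finset.sum_mul_sum,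
    ← Finset.sum_product', ← (Equiv.ofBijective _ (bijective_mul_add_mul h)).sum_comp]
  refine Finset.sum_congr (by simp) fun p _ ↦ ?_
  rw [Equiv.ofBijective_apply, stdAddChar_mul_add_mul, quadTwist]
  simp only [map_intCast, smul_eq_mul]
  push_cast
  simp only [ZMod.natCast_self, ZMod.natCast_zmod_val, zero_mul, add_zero, zero_add]
  ring

lemma stdAddChar_mul_sq {d : ℕ} [NeZero d] (b n : ℤ) :
    ZMod.stdAddChar ((b : ZMod d) * (n : ZMod d) ^ 2) =
      Complex.exp (2 * π * Complex.I * (n : ℂ) ^ 2 * (b / d)) := by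
  have := ZMod.stdAddChar_coe (N := d) (b * n ^ 2)
  push_cast at this
  rw [this]
  congr 1
  ring

lemma thetaSeries_quadTwist {N d : ℕ} [NeZero d] (f : ZMod N → ℂ) (b : ℤ) (w : ℂ) :
    thetaSeries (quadTwist f d b) w = thetaSeries f (b / d + w) := by
  refine tsum_congr fun n ↦ ?_
  rw [quadTwist]
  simp only [map_intCast]
  rw [stdAddChar_mul_sq, mul_assoc, ← Complex.exp_add, ← mul_add]

lemma thetaSeries_dft_quadTwist {N d : ℕ} [NeZero N] [NeZero d] (h : N.Coprime d)
    (f : ZMod N → ℂ) {b b' : ℤ} (hb : (4 * (N : ZMod d) ^ 2 * (b : ZMod d) * (b' : ZMod d) : ZMod d) = -1) (w : ℂ) :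
    thetaSeries (ZMod.dft (quadTwist f d b)) w =
      quadGauss d b * thetaSeries (ZMod.dft fun x ↦ f ((d : ZMod N) * x)) (b' / d + w) := by
  rw [thetaSeries, thetaSeries, ← tsum_mul_left]
  refine tsum_congr fun n ↦ ?_
  rw [dft_quadTwist h f hb, stdAddChar_mul_sq, mul_add _ _ w, Complex.exp_add]
  ring

lemma neg_I_mul_ne_zero {σ : ℂ} (hσ : 0 < σ.im) : -Complex.I * σ ≠ 0 := by
  refine mul_ne_zero (by simp) ?_
  rintro rfl
  simp at hσ

lemma arg_neg_I_mul_ne_pi {σ : ℂ} (hσ : 0 < σ.im) : (-Complex.I * σ).arg ≠ π := by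
  intro h
  have := (Complex.arg_eq_pi_iff.mp h).1
  simp at this
  linarith

lemma ofReal_mul_cpow_half {c : ℝ} (hc : 0 < c) (z : ℂ) :
    ((c : ℂ) * z) ^ (1 / 2 : ℂ) = √c * z ^ (1 / 2 : ℂ) := by
  rcases eq_or_ne z 0 with rfl | hz
  · simp
  have hc' : (c : ℂ) ≠ 0 := Complex.ofReal_ne_zero.mpr hc.ne'
  rw [Complex.cpow_def_of_ne_zero (mul_ne_zero hc' hz), Complex.log_ofReal_mul hc hz, add_mul,
    Complex.exp_add, ← Complex.cpow_def_of_ne_zero hz, Complex.ofReal_log hc.le,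
    ← Complex.cpow_def_of_ne_zero hc', Real.sqrt_eq_rpow, Complex.ofReal_cpow hc.le]
  push_cast
  rfl

lemma inv_div_cpow_half {σ : ℂ} (hσ : 0 < σ.im) {c : ℝ} (hc : 0 < c) :
    1 / ((c : ℂ) * (-Complex.I * σ)⁻¹) ^ (1 / 2 : ℂ) =
      (√c : ℂ)⁻¹ * (-Complex.I * σ) ^ (1 / 2 : ℂ) := by
  rw [ofReal_mul_cpow_half hc, Complex.inv_cpow _ _ (arg_neg_I_mul_ne_pi hσ), one_div, mul_inv,
    inv_inv]

/-- The behaviour of theta series with coefficients of period `N` at the rational point `b / d`,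
for `d` prime to `N`. -/
theorem thetaSeries_inversion {N d : ℕ} [NeZero N] [NeZero d] (h : N.Coprime d)
    (f : ZMod N → ℂ) {b b' : ℤ} (hb : (4 * (N : ZMod d) ^ 2 * (b : ZMod d) * (b' : ZMod d) : ZMod d) = -1) {σ : ℂ}
    (hσ : 0 < σ.im) :
    thetaSeries f ((b - 1 / σ) / d) = (√(2 / d) * N * d : ℂ)⁻¹ * quadGauss d b *
      (-Complex.I * σ) ^ (1 / 2 : ℂ) *
        thetaSeries (ZMod.dft fun x ↦ f ((d : ZMod N) * x)) ((σ / (4 * N ^ 2) + b') / d) := by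
  have hd : (d : ℂ) ≠ 0 := NeZero.ne _
  have hd' : (0 : ℝ) < d := Nat.cast_pos.mpr (NeZero.pos d)
  have hN : (N : ℂ) ≠ 0 := NeZero.ne _
  have hσ0 : σ ≠ 0 := by rintro rfl; simp at hσ
  have hw : 0 < (-1 / (d * σ)).im := by
    have : (-1 / (d * σ) : ℂ) = ((1 / d : ℝ) : ℂ) * (-σ)⁻¹ := by push_cast; field_simp
    rw [this, Complex.im_ofReal_mul, Complex.inv_im]
    have := div_pos hσ (Complex.normSq_pos.mpr hσ0)
    simp only [Complex.neg_im, neg_neg, Complex.normSq_neg]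
    positivity
  have h1 : (b - 1 / σ) / d = b / d + -1 / (d * σ) := by field_simp; ring
  have h2 : -1 / (4 * ((N * d : ℕ) : ℂ) ^ 2 * (-1 / (d * σ))) = σ / (4 * N ^ 2) / d := by
    push_cast; field_simp
  have h3 : -Complex.I * (2 * (-1 / (d * σ))) = ((2 / d : ℝ) : ℂ) * (-Complex.I * σ)⁻¹ := by
    push_cast
    field_simp
    rw [Complex.I_sq]
  rw [h1, ← thetaSeries_quadTwist, thetaSeries_eq_tsum_dft _ hw, thetaSeries_dft_quadTwist h f hb,
    h2, h3, inv_div_cpow_half hσ (by positivity), add_div, add_comm (_ / (d : ℂ)) (_ / (d : ℂ))]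
  push_cast
  ring

end Inversion

/-! ### The pentagonal number theorem and the theta series of η -/

section Eta

/-- From `1 + t ≤ exp t`; the uniformity in `k` and `n` is what dominates the remainder in the
pentagonal identity. -/
lemma norm_prod_one_sub_pow_le {x : ℂ} (hx : ‖x‖ < 1) (k n : ℕ) :
    ‖∏ i ∈ Finset.range n, (1 - x ^ (k + i + 1))‖ ≤ Real.exp (1 - ‖x‖)⁻¹ := by
  rw [norm_prod]
  calc ∏ i ∈ Finset.range n, ‖1 - x ^ (k + i + 1)‖
      ≤ ∏ i ∈ Finset.range n, Real.exp (‖x‖ ^ i) := by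
        refine Finset.prod_le_prod (fun _ _ ↦ norm_nonneg _) fun i _ ↦ ?_
        refine (norm_sub_le _ _).trans ?_
        rw [norm_one, norm_pow, add_comm]
        refine le_trans ?_ (Real.add_one_le_exp _)
        exact add_le_add_left (pow_le_pow_of_le_one (norm_nonneg _) hx.le (by omega)) 1
    _ = Real.exp (∑ i ∈ Finset.range n, ‖x‖ ^ i) := (Real.exp_sum _ _).symm
    _ ≤ Real.exp (1 - ‖x‖)⁻¹ := by
        gcongr
        rw [← tsum_geometric_of_lt_one (norm_nonneg _) hx]
        exact (summable_geometric_of_lt_one (norm_nonneg _) hx).sum_le_tsum _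
          fun _ _ ↦ by positivity

lemma le_pentagonal_neg (k : ℕ) : k ≤ pentagonal (-(k : ℤ)) := by
  have := two_mul_natCast_pentagonal_neg (k : ℤ)
  zify
  nlinarith [sq_nonneg (k : ℤ), Int.natCast_nonneg k, sq_nonneg ((k : ℤ) - 1), Int.le_self_sq (k : ℤ)]

lemma le_pentagonal_add_one (k : ℕ) : k ≤ pentagonal ((k : ℤ) + 1) := by
  have := two_mul_natCast_pentagonal ((k : ℤ) + 1)
  zify
  nlinarith [Int.le_self_sq (k : ℤ), Int.natCast_nonneg k]

/-- The pentagonal number theorem in the unit disc. -/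
theorem tprod_one_sub_pow_eq_tsum {x : ℂ} (hx : ‖x‖ < 1) :
    ∏' n : ℕ, (1 - x ^ (n + 1)) =
      ∑' k : ℕ, (-1) ^ k * (x ^ pentagonal (-k) - x ^ pentagonal (k + 1)) := by
  have hgeo := summable_geometric_of_lt_one (norm_nonneg _) hx
  have hbound : ∀ k n : ℕ, ‖x ^ ((k + 1) * n) * ∏ i ∈ Finset.range (n + 1), (1 - x ^ (k + i + 1))‖ ≤
      Real.exp (1 - ‖x‖)⁻¹ * ‖x‖ ^ n := by
    intro k n
    rw [norm_mul, norm_pow, mul_comm]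
    exact mul_le_mul (norm_prod_one_sub_pow_le hx k (n + 1))
      (pow_le_pow_of_le_one (norm_nonneg _) hx.le (Nat.le_mul_of_pos_left n k.succ_pos))
      (by positivity) (by positivity)
  have hsum : ∀ k : ℕ, Summable fun n ↦
      x ^ ((k + 1) * n) * ∏ i ∈ Finset.range (n + 1), (1 - x ^ (k + i + 1)) := fun k ↦
    .of_norm_bounded (hgeo.mul_left _) (hbound k)
  refine Pentagonal.tprod_one_sub_pow (tendsto_pow_atTop_nhds_zero_of_norm_lt_one hx) hsum
    (fun k ↦ ?_) ?_ ?_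
  · simp_rw [sub_eq_add_neg]
    refine multipliable_one_add_of_summable ?_
    simp only [norm_neg, norm_pow]
    simpa only [add_assoc] using (summable_nat_add_iff (k + 1)).mpr hgeo
  · refine .of_norm_bounded (hgeo.mul_left 2) fun k ↦ ?_
    rw [norm_mul, norm_pow, norm_neg, norm_one, one_pow, one_mul, two_mul]
    refine (norm_sub_le _ _).trans ?_
    rw [norm_pow, norm_pow]
    exact add_le_add (pow_le_pow_of_le_one (norm_nonneg _) hx.le (le_pentagonal_neg k))
      (pow_le_pow_of_le_one (norm_nonneg _) hx.le (le_pentagonal_add_one k))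
  · refine squeeze_zero_norm (a := fun k ↦ ‖x‖ ^ k * (Real.exp (1 - ‖x‖)⁻¹ * (1 - ‖x‖)⁻¹))
      (fun k ↦ ?_) ?_
    · rw [norm_mul, norm_mul, norm_pow, norm_neg, norm_one, one_pow, one_mul, norm_pow]
      refine mul_le_mul (pow_le_pow_of_le_one (norm_nonneg _) hx.le ?_) ?_ (norm_nonneg _)
        (by positivity)
      · rw [Nat.le_div_iff_mul_le two_pos]
        nlinarith
      · exact tsum_of_norm_bounded ((hasSum_geometric_of_lt_one (norm_nonneg _) hx).mul_left _)
          (hbound k)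
    · simpa using (tendsto_pow_atTop_nhds_zero_of_lt_one (norm_nonneg _) hx).mul_const
        (Real.exp (1 - ‖x‖)⁻¹ * (1 - ‖x‖)⁻¹)

lemma chiTwelve_apply (x : ZMod 12) : chiTwelve x = (chiTwelveInt x : ℂ) := rfl

lemma chiTwelveInt_neg (x : ZMod 12) : chiTwelveInt (-x) = chiTwelveInt x := by
  revert x; decide

lemma chiTwelve_neg (x : ZMod 12) : chiTwelve (-x) = chiTwelve x := by
  rw [chiTwelve_apply, chiTwelveInt_neg, chiTwelve_apply]

lemma chiTwelveInt_mul_six_add_one (m : ℤ) :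
    chiTwelveInt ((m * 6 + 1 : ℤ) : ZMod 12) = Int.negOnePow m := by
  have h12 : (12 : ZMod 12) = 0 := by decide
  obtain ⟨k, rfl⟩ | ⟨k, rfl⟩ := Int.even_or_odd m
  · rw [Int.negOnePow_even _ ⟨k, rfl⟩]
    have : (((k + k) * 6 + 1 : ℤ) : ZMod 12) = 1 := by
      push_cast; linear_combination (k : ZMod 12) * h12
    rw [this]; decide
  · rw [Int.negOnePow_odd _ ⟨k, rfl⟩]
    have : (((2 * k + 1) * 6 + 1 : ℤ) : ZMod 12) = 7 := by
      push_cast; linear_combination (k : ZMod 12) * h12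
    rw [this]; decide

lemma chiTwelveInt_mul_six_add (m : ℤ) {j : ℤ} (hj : j = 0 ∨ j = 2 ∨ j = 3 ∨ j = 4) :
    chiTwelveInt ((m * 6 + j : ℤ) : ZMod 12) = 0 := by
  have h : ∀ x y : ZMod 12, y = 0 ∨ y = 2 ∨ y = 3 ∨ y = 4 → chiTwelveInt (x * 6 + y) = 0 := by
    decide
  push_cast
  refine h _ _ ?_
  rcases hj with rfl | rfl | rfl | rfl <;> simp

/-- The exponents combine by `1 / 24 + k (3 k + 1) / 2 = (6 k + 1)² / 24`. -/
lemma qParam_pow_pentagonal_neg (z : ℂ) (k : ℤ) :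
    Function.Periodic.qParam 24 z * Function.Periodic.qParam 1 z ^ pentagonal (-k) =
      Complex.exp (2 * π * Complex.I * ((k * 6 + 1 : ℤ) : ℂ) ^ 2 * (z / 24)) := by
  have h : (2 * (pentagonal (-k)) : ℂ) = k * (3 * k + 1) := by
    exact_mod_cast two_mul_natCast_pentagonal_neg k
  rw [Function.Periodic.qParam, Function.Periodic.qParam, ← Complex.exp_nat_mul, ← Complex.exp_add]
  congr 1
  push_cast
  field_simp
  linear_combination 12 * z * h

/-- The theta series of `η`. -/
theorem eta_eq_thetaSeries {z : ℂ} (hz : 0 < z.im) :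
    eta z = 2⁻¹ * thetaSeries chiTwelve (z / 24) := by
  have hq : ‖Function.Periodic.qParam 1 z‖ < 1 := by
    simpa using UpperHalfPlane.norm_qParam_lt_one 1 ⟨z, hz⟩
  have hz' : 0 < (z / 24).im := by simpa [Complex.div_im] using by positivity
  set T : ℤ → ℂ := fun k ↦ (Int.negOnePow k : ℂ) *
    Complex.exp (2 * π * Complex.I * ((k * 6 + 1 : ℤ) : ℂ) ^ 2 * (z / 24)) with hT
  have hsT : Summable T := by
    refine .of_norm ?_
    refine ((summable_cexp_sq hz').comp_injective
      (i := fun k : ℤ ↦ k * 6 + 1) fun a b h ↦ by simpa using h).congr fun k ↦ ?_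
    simp [hT]
  have h1 : eta z = ∑' k, T k := by
    rw [eta, tprod_one_sub_pow_eq_tsum hq, ← tsum_mul_left]
    refine (HasSum.tsum_eq ?_)
    -- The two-sided series is folded by pairing `k` with `-(k + 1)`, which is the grouping in the
    -- pentagonal identity.
    refine (hsT.hasSum.nat_add_neg_add_one.congr_fun fun k ↦ ?_)
    have e1 := qParam_pow_pentagonal_neg z k
    have e2 := qParam_pow_pentagonal_neg z (-(k + 1))
    rw [neg_neg] at e2
    simp only [hT]
    rw [← e1, ← e2, Int.negOnePow_neg, Int.negOnePow_succ]
    push_cast [Int.coe_negOnePow]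
    rw [Int.natAbs_natCast]
    ring
  -- Modulo 6 only the classes 1 and 5 carry nonzero coefficients. They are interchanged by `n ↦
  -- -n`, so each contributes the whole series of η; hence the factor 2.
  have h2 : thetaSeries chiTwelve (z / 24) = 2 * ∑' k, T k := by
    rw [thetaSeries, tsum_int_eq_sum_fin 6 (summable_mul_cexp_sq hz' _), Fin.sum_univ_six]
    have hz : ∀ j : ℤ, j = 0 ∨ j = 2 ∨ j = 3 ∨ j = 4 → ∑' m : ℤ, chiTwelve ((m * 6 + j : ℤ) :
        ZMod 12) * Complex.exp (2 * π * Complex.I * ((m * 6 + j : ℤ) : ℂ) ^ 2 * (z / 24)) = 0 := by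
      intro j hj
      simp_rw [chiTwelve_apply, chiTwelveInt_mul_six_add _ hj]
      simp
    have h5 : ∑' m : ℤ, chiTwelve ((m * 6 + 5 : ℤ) : ZMod 12) *
        Complex.exp (2 * π * Complex.I * ((m * 6 + 5 : ℤ) : ℂ) ^ 2 * (z / 24)) = ∑' m, T m := by
      rw [← (Equiv.subLeft (-1 : ℤ)).tsum_eq]
      refine tsum_congr fun m ↦ ?_
      have : (Equiv.subLeft (-1 : ℤ)) m * 6 + 5 = -(m * 6 + 1) := by
        simp only [Equiv.subLeft_apply]; ring
      rw [this, Int.cast_neg, chiTwelve_neg, chiTwelve_apply, chiTwelveInt_mul_six_add_one,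
        Int.cast_neg, neg_sq]
    have h1 : ∑' m : ℤ, chiTwelve ((m * 6 + 1 : ℤ) : ZMod 12) *
        Complex.exp (2 * π * Complex.I * ((m * 6 + 1 : ℤ) : ℂ) ^ 2 * (z / 24)) = ∑' m, T m := by
      refine tsum_congr fun m ↦ ?_
      rw [chiTwelve_apply, chiTwelveInt_mul_six_add_one]
    refine (congrArg₂ (· + ·) (congrArg₂ (· + ·) (congrArg₂ (· + ·) (congrArg₂ (· + ·)
      (congrArg₂ (· + ·) (hz 0 (by simp)) h1) (hz 2 (by simp))) (hz 3 (by simp)))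
      (hz 4 (by simp))) h5).trans ?_
    ring
  rw [h1, h2]
  ring

end Eta

/-! ### χ₁₂ as its own Fourier transform; inversion of η and θ -/

section EtaInversion

lemma stdAddChar_twelve_one :
    ZMod.stdAddChar (1 : ZMod 12) = ((√3 : ℝ) + Complex.I) / 2 := by
  have h := ZMod.stdAddChar_coe (N := 12) 1
  push_cast at h
  rw [h, show 2 * (π : ℂ) * Complex.I * 1 / 12 = ((π / 6 : ℝ) : ℂ) * Complex.I by push_cast; ring,
    Complex.exp_mul_I, ← Complex.ofReal_cos, ← Complex.ofReal_sin, Real.cos_pi_div_six,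
    Real.sin_pi_div_six]
  push_cast
  ring

lemma stdAddChar_twelve_natCast (n : ℕ) :
    ZMod.stdAddChar (n : ZMod 12) = (((√3 : ℝ) + Complex.I) / 2) ^ n := by
  rw [← stdAddChar_twelve_one, ← AddChar.map_nsmul_eq_pow, nsmul_one]

lemma ofReal_sqrt_three_sq : ((√3 : ℝ) : ℂ) ^ 2 = 3 := by
  rw [← Complex.ofReal_pow, Real.sq_sqrt (by norm_num)]
  norm_num

lemma ofReal_sqrt_twelve : ((√12 : ℝ) : ℂ) = 2 * (√3 : ℝ) := by
  rw [show (12 : ℝ) = 2 ^ 2 * 3 by norm_num, Real.sqrt_mul (by norm_num),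
    Real.sqrt_sq (by norm_num)]
  push_cast
  rfl

/-- The Gauss sum of the primitive even character χ₁₂, which is why it holds for `k` not prime to 12
as well. The twelve cases are reduced with `z³ = i` and `z⁶ = -1` for `z = exp(2πi / 12)`. -/
lemma sum_stdAddChar_twelve (k : ZMod 12) :
    ZMod.stdAddChar (-k) - ZMod.stdAddChar (-(5 * k)) - ZMod.stdAddChar (5 * k) +
      ZMod.stdAddChar k = ((√12 : ℝ) : ℂ) * (chiTwelveInt k : ℂ) := by
  set z : ℂ := ((√3 : ℝ) + Complex.I) / 2 with hz
  have h3 := ofReal_sqrt_three_sq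
  have z3 : z ^ 3 = Complex.I := by
    rw [hz]
    linear_combination (((√3 : ℝ) : ℂ) / 8 + 3 * Complex.I / 8) * h3 +
      (3 * ((√3 : ℝ) : ℂ) / 8 + Complex.I / 8) * Complex.I_sq
  have z6 : z ^ 6 = -1 := by
    rw [show z ^ 6 = (z ^ 3) ^ 2 by ring, z3, Complex.I_sq]
  have z5 : z ^ 5 = z - (√3 : ℝ) := by
    rw [show z ^ 5 = z ^ 3 * z ^ 2 by ring, z3, hz]
    linear_combination (Complex.I / 4) * h3 + (Complex.I / 4 + ((√3 : ℝ) : ℂ) / 2) * Complex.I_sq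
  rw [ofReal_sqrt_twelve]
  have E : ∀ n : ℕ, ZMod.stdAddChar (n : ZMod 12) = z ^ n := stdAddChar_twelve_natCast
  have e1 := E 1
  have e2 := E 2
  have e3 := E 3
  have e4 := E 4
  have e5 : ZMod.stdAddChar ((5 : ℕ) : ZMod 12) = z - (√3 : ℝ) := (E 5).trans z5
  have e6 : ZMod.stdAddChar ((6 : ℕ) : ZMod 12) = -1 := (E 6).trans z6
  have e7 : ZMod.stdAddChar ((7 : ℕ) : ZMod 12) = -z := (E 7).trans (by linear_combination z * z6)
  have e8 : ZMod.stdAddChar ((8 : ℕ) : ZMod 12) = -z ^ 2 :=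
    (E 8).trans (by linear_combination z ^ 2 * z6)
  have e9 : ZMod.stdAddChar ((9 : ℕ) : ZMod 12) = -z ^ 3 :=
    (E 9).trans (by linear_combination z ^ 3 * z6)
  have e10 : ZMod.stdAddChar ((10 : ℕ) : ZMod 12) = -z ^ 4 :=
    (E 10).trans (by linear_combination z ^ 4 * z6)
  have e11 : ZMod.stdAddChar ((11 : ℕ) : ZMod 12) = -(z - (√3 : ℝ)) :=
    (E 11).trans (by linear_combination z ^ 5 * z6 - z5)
  push_cast at e1 e2 e3 e4 e5 e6 e7 e8 e9 e10 e11
  have hk : k = 0 ∨ k = 1 ∨ k = 2 ∨ k = 3 ∨ k = 4 ∨ k = 5 ∨ k = 6 ∨ k = 7 ∨ k = 8 ∨ k = 9 ∨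
      k = 10 ∨ k = 11 := by revert k; decide
  have c1 : ∀ k : ZMod 12, k ∈ ({1, 11} : Finset (ZMod 12)) → chiTwelveInt k = 1 := by decide
  have c5 : ∀ k : ZMod 12, k ∈ ({5, 7} : Finset (ZMod 12)) → chiTwelveInt k = -1 := by decide
  have c0 : ∀ k : ZMod 12, k ∉ ({1, 5, 7, 11} : Finset (ZMod 12)) → chiTwelveInt k = 0 := by decide
  rcases hk with rfl | rfl | rfl | rfl | rfl | rfl | rfl | rfl | rfl | rfl | rfl | rfl
  all_goals first | rw [c1 _ (by decide)] | rw [c5 _ (by decide)] | rw [c0 _ (by decide)]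
  all_goals norm_num
  all_goals reduce_mod_char
  all_goals simp only [e1, e2, e3, e4, e5, e6, e7, e8, e9, e10, e11]
  all_goals ring

/-- This self-duality makes η, and not some other theta series, reappear after inversion. -/
lemma dft_chiTwelve : ZMod.dft (chiTwelve : ZMod 12 → ℂ) =
    fun k ↦ ((√12 : ℝ) : ℂ) * chiTwelve k := by
  funext k
  have c0 : ∀ k : ZMod 12, k ∉ ({1, 5, 7, 11} : Finset (ZMod 12)) → chiTwelveInt k = 0 := by decide
  rw [ZMod.dft_apply, ← Finset.sum_subset (Finset.subset_univ ({1, 5, 7, 11} : Finset (ZMod 12)))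
    fun x _ hx ↦ by rw [chiTwelve_apply, c0 x hx]; simp]
  rw [Finset.sum_insert (by decide), Finset.sum_insert (by decide), Finset.sum_insert (by decide),
    Finset.sum_singleton]
  simp only [chiTwelve_apply]
  rw [← sum_stdAddChar_twelve k, show chiTwelveInt 1 = 1 by decide,
    show chiTwelveInt 5 = -1 by decide, show chiTwelveInt 7 = -1 by decide,
    show chiTwelveInt 11 = 1 by decide, show (7 : ZMod 12) = -5 by decide,
    show (11 : ZMod 12) = -1 by decide]
  simp only [neg_mul, neg_neg, one_mul, smul_eq_mul]
  push_cast
  ring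

lemma thetaSeries_const_mul {N : ℕ} (c : ℂ) (f : ZMod N → ℂ) (w : ℂ) :
    thetaSeries (fun x ↦ c * f x) w = c * thetaSeries f w := by
  rw [thetaSeries, thetaSeries, ← tsum_mul_left]
  exact tsum_congr fun n ↦ mul_assoc _ _ _

/-- Source of the nebentypus: the dilation by `d` in the inversion formula becomes the scalar
χ₁₂(d). -/
lemma dft_chiTwelve_mul (d : ZMod 12) : ZMod.dft (fun x : ZMod 12 ↦ chiTwelve (d * x)) =
    fun x ↦ (chiTwelve d * ((√12 : ℝ) : ℂ)) * chiTwelve x := by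
  have : (fun x : ZMod 12 ↦ chiTwelve (d * x)) = fun x ↦ chiTwelve d * chiTwelve x := by
    funext x; exact map_mul _ _ _
  rw [this]
  have h := ZMod.dft_const_mul (chiTwelve d) (chiTwelve : ZMod 12 → ℂ)
  rw [h, dft_chiTwelve]
  funext x
  ring

/-- The behaviour of `η` at the rational point `24 b / d`, for `d` prime to `6`. -/
theorem eta_inversion {d : ℕ} [NeZero d] (h : Nat.Coprime 12 d) {b b' : ℤ}
    (hb : (d : ℤ) ∣ 576 * b * b' + 1) {σ : ℂ} (hσ : 0 < σ.im) :
    eta ((24 * b - 1 / σ) / d) = chiTwelve (d : ZMod 12) * (quadGauss d b / (√d : ℝ)) *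
      (-Complex.I * σ) ^ (1 / 2 : ℂ) * eta ((σ + 24 * b') / d) := by
  have hd : (d : ℂ) ≠ 0 := NeZero.ne _
  have hd' : (0 : ℝ) < d := Nat.cast_pos.mpr (NeZero.pos d)
  have hσ0 : σ ≠ 0 := by rintro rfl; simp at hσ
  have hσ' : 0 < (24 * σ).im := by simpa using hσ
  have hb' : (4 * ((12 : ℕ) : ZMod d) ^ 2 * (b : ZMod d) * (b' : ZMod d) : ZMod d) = -1 := by
    have := (ZMod.intCast_zmod_eq_zero_iff_dvd _ _).mpr hb
    push_cast at this ⊢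
    linear_combination this
  have him1 : 0 < ((24 * b - 1 / σ) / d).im := by
    rw [Complex.div_natCast_im]
    refine div_pos ?_ hd'
    have := div_pos hσ (Complex.normSq_pos.mpr hσ0)
    simpa [Complex.inv_im, neg_div] using this
  have him2 : 0 < ((σ + 24 * b') / d).im := by
    rw [Complex.div_natCast_im]
    refine div_pos ?_ hd'
    simpa using hσ
  have e1 : (24 * b - 1 / σ) / d / 24 = (b - 1 / (24 * σ)) / d := by field_simp
  have e2 : (24 * σ / (4 * ((12 : ℕ) : ℂ) ^ 2) + b') / d = (σ + 24 * b') / d / 24 := by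
    push_cast; field_simp; ring
  have e3 : -Complex.I * (24 * σ) = ((24 : ℝ) : ℂ) * (-Complex.I * σ) := by push_cast; ring
  rw [eta_eq_thetaSeries him1, eta_eq_thetaSeries him2, e1, thetaSeries_inversion h _ hb' hσ', e2,
    dft_chiTwelve_mul, thetaSeries_const_mul, e3, ofReal_mul_cpow_half (by norm_num)]
  -- `√24` comes from rescaling `σ` to `24 σ`, `√12` from the Fourier transform of χ₁₂; together
  -- they cancel the normalisation in `thetaSeries_inversion` up to `√d`.
  have hc : (√24 : ℝ) * √12 * √d = √(2 / d) * 12 * d := by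
    rw [← Real.sqrt_mul (by norm_num), ← Real.sqrt_mul (by norm_num), Real.sqrt_eq_iff_mul_self_eq
      (by positivity) (by positivity)]
    have : √(2 / d) * √(2 / d) = 2 / d := Real.mul_self_sqrt (by positivity)
    symm
    calc √(2 / d) * 12 * d * (√(2 / d) * 12 * d) = √(2 / d) * √(2 / d) * (144 * d ^ 2) := by ring
      _ = 2 / d * (144 * d ^ 2) := by rw [this]
      _ = 24 * 12 * d := by field_simp; norm_num
  have hc' : ((√(2 / d) : ℝ) * 12 * d : ℂ) = (√24 : ℝ) * (√12 : ℝ) * (√d : ℝ) := by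
    exact_mod_cast hc.symm
  push_cast at hc' ⊢
  rw [hc']
  have h24 : ((√24 : ℝ) : ℂ) ≠ 0 := by simp
  have h12 : ((√12 : ℝ) : ℂ) ≠ 0 := by simp
  have hsd : ((√d : ℝ) : ℂ) ≠ 0 := by simpa using NeZero.ne d
  field_simp

lemma jacobiTheta_eq_thetaSeries (w : ℂ) :
    jacobiTheta (2 * w) = thetaSeries (fun _ : ZMod 1 ↦ 1) w := by
  refine tsum_congr fun n ↦ ?_
  rw [one_mul]
  congr 1
  ring

/-- The behaviour of the theta function at the rational point `b / d`, for `d` odd. -/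
theorem jacobiTheta_inversion {d : ℕ} [NeZero d] {b b' : ℤ}
    (hb : (d : ℤ) ∣ 4 * b * b' + 1) {σ : ℂ} (hσ : 0 < σ.im) :
    jacobiTheta (2 * ((b - 1 / σ) / d)) = (√2 : ℝ)⁻¹ * (quadGauss d b / (√d : ℝ)) *
      (-Complex.I * σ) ^ (1 / 2 : ℂ) * jacobiTheta (2 * ((σ / 4 + b') / d)) := by
  have hd' : (0 : ℝ) < d := Nat.cast_pos.mpr (NeZero.pos d)
  have hb' : (4 * ((1 : ℕ) : ZMod d) ^ 2 * (b : ZMod d) * (b' : ZMod d) : ZMod d) = -1 := by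
    have := (ZMod.intCast_zmod_eq_zero_iff_dvd _ _).mpr hb
    push_cast at this ⊢
    linear_combination this
  have hdft : ZMod.dft (fun x : ZMod 1 ↦ (fun _ : ZMod 1 ↦ (1 : ℂ)) ((d : ZMod 1) * x)) =
      fun _ ↦ 1 := by
    funext k
    rw [ZMod.dft_apply]
    simp [Subsingleton.elim _ (0 : ZMod 1)]
  rw [jacobiTheta_eq_thetaSeries, jacobiTheta_eq_thetaSeries,
    thetaSeries_inversion (Nat.coprime_one_left d) _ hb' hσ, hdft]
  have hc : √(2 / d) * 1 * d = √2 * √d := by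
    rw [Real.sqrt_div (by norm_num)]
    field_simp
    rw [Real.sq_sqrt hd'.le]
  have hc' : ((√(2 / d) : ℝ) * 1 * d : ℂ) = (√2 : ℝ) * (√d : ℝ) := by exact_mod_cast hc
  push_cast at hc' ⊢
  rw [hc', mul_inv]
  simp only [one_pow, mul_one]
  ring

end EtaInversion

/-! ### Nonvanishing of θ on the upper half plane -/

section ThetaNeZero

/-- The three Jacobi theta constants do not vanish at `τ`; they are given as values of one of
them at `τ`, `τ + 1` and `1 - 1 / τ`. -/
def ThetaConstantsNeZero (τ : ℍ) : Prop :=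
  jacobiTheta τ ≠ 0 ∧ jacobiTheta (τ + 1) ≠ 0 ∧ jacobiTheta (1 - 1 / τ) ≠ 0

lemma jacobiTheta_neg_inv {z : ℂ} (hz : 0 < z.im) :
    jacobiTheta (-1 / z) = 0 ↔ jacobiTheta z = 0 := by
  have h := jacobiTheta_S_smul ⟨z, hz⟩
  rw [UpperHalfPlane.modular_S_smul] at h
  simp only at h
  rw [show -1 / z = (-z)⁻¹ by rw [inv_neg, neg_div, one_div], h, mul_eq_zero, or_iff_right]
  rw [Complex.cpow_eq_zero_iff]
  exact fun hc ↦ neg_I_mul_ne_zero hz hc.1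

lemma im_neg_inv_pos {z : ℂ} (hz : 0 < z.im) : 0 < (-1 / z).im := by
  have hz0 : z ≠ 0 := by rintro rfl; simp at hz
  have := div_pos hz (Complex.normSq_pos.mpr hz0)
  simpa [Complex.div_im, neg_div] using this

lemma thetaConstantsNeZero_T (τ : ℍ) :
    ThetaConstantsNeZero (ModularGroup.T • τ) ↔ ThetaConstantsNeZero τ := by
  have hτ := τ.im_pos
  have hτ0 := τ.ne_zero
  have hτ1 : (τ : ℂ) + 1 ≠ 0 := by
    intro h
    have := congrArg Complex.im h
    simp at this
    exact hτ.ne' this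
  have e1 : ((ModularGroup.T • τ : ℍ) : ℂ) = τ + 1 := by
    rw [UpperHalfPlane.modular_T_smul]; simp [add_comm]
  have e2 : jacobiTheta (τ + 1 + 1) = jacobiTheta τ := by
    rw [show (τ + 1 + 1 : ℂ) = 2 + τ by ring, jacobiTheta_two_add]
  have e3 : jacobiTheta (1 - 1 / (τ + 1)) = 0 ↔ jacobiTheta (1 - 1 / τ) = 0 := by
    have him : 0 < (1 - 1 / (τ + 1) : ℂ).im := by
      have := im_neg_inv_pos (z := τ + 1) (by simpa using hτ)
      rw [sub_eq_add_neg, ← neg_div]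
      simpa using this
    rw [← jacobiTheta_neg_inv him, ← jacobiTheta_two_add]
    suffices (2 + -1 / (1 - 1 / (τ + 1)) : ℂ) = 1 - 1 / τ by rw [this]
    have : (1 - 1 / (τ + 1) : ℂ) = τ / (τ + 1) := by field_simp; ring
    rw [this]
    field_simp
    ring
  rw [ThetaConstantsNeZero, ThetaConstantsNeZero, e1, e2, Ne, Ne, Ne, e3]
  tauto

lemma thetaConstantsNeZero_S (τ : ℍ) :
    ThetaConstantsNeZero (ModularGroup.S • τ) ↔ ThetaConstantsNeZero τ := by
  have hτ := τ.im_pos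
  have hτ0 := τ.ne_zero
  have e1 : ((ModularGroup.S • τ : ℍ) : ℂ) = -1 / τ := by
    rw [UpperHalfPlane.modular_S_smul]; simp [inv_neg, neg_div]
  have e2 : (1 - 1 / (-1 / τ) : ℂ) = τ + 1 := by field_simp; ring
  have e3 : (-1 / τ + 1 : ℂ) = 1 - 1 / τ := by ring
  rw [ThetaConstantsNeZero, ThetaConstantsNeZero, e1, e2, e3, Ne, Ne, Ne,
    jacobiTheta_neg_inv hτ]
  tauto

/-- Up to nonvanishing factors, `T` and `S` permute the three theta constants, so their joint
nonvanishing is invariant under the full modular group, while that of a single one is not visibly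
so. -/
lemma thetaConstantsNeZero_smul (γ : SL(2, ℤ)) :
    ∀ τ : ℍ, ThetaConstantsNeZero (γ • τ) ↔ ThetaConstantsNeZero τ := by
  have hγ : γ ∈ Subgroup.closure {ModularGroup.S, ModularGroup.T} := by
    rw [SpecialLinearGroup.SL2Z_generators]; trivial
  induction hγ using Subgroup.closure_induction with
  | mem x hx =>
    rcases hx with rfl | rfl
    · exact thetaConstantsNeZero_S
    · exact thetaConstantsNeZero_T
  | one => simp
  | mul x y _ _ hx hy => intro τ; rw [mul_smul, hx, hy]
  | inv x _ hx => intro τ; rw [← hx, smul_inv_smul]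

/-- The threshold `3 / 4` lies below `√3 / 2`, the least height in the fundamental domain; `1 / 3`
is where `2 x / (1 - x)` reaches 1. -/
lemma exp_neg_pi_mul_lt {y : ℝ} (hy : 3 / 4 < y) : Real.exp (-π * y) < 1 / 3 := by
  have h1 : (2 : ℝ) < π * y := by nlinarith [Real.pi_gt_three]
  have h2 : (3 : ℝ) < Real.exp (π * y) := by
    have := Real.add_one_lt_exp (x := π * y) (by linarith)
    linarith
  rw [neg_mul, Real.exp_neg, one_div]
  exact inv_strictAnti₀ (by norm_num) h2

lemma jacobiTheta_ne_zero_of_im {z : ℂ} (hz : 3 / 4 < z.im) : jacobiTheta z ≠ 0 := by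
  intro h
  have hx := exp_neg_pi_mul_lt hz
  have := norm_jacobiTheta_sub_one_le (τ := z) (by linarith)
  rw [h, zero_sub, norm_neg, norm_one, div_mul_eq_mul_div, le_div_iff₀ (by linarith)] at this
  linarith

/-- Up to a factor that is only needed when the left side vanishes, inversion turns this value into
`∑ exp(πi n (n + 1) z)`. Pairing `n` with `-n - 1` writes that sum as `2 (1 + ε)`, where `|ε| ≤ x /
(1 - x) < 1`. -/
lemma jacobiTheta_one_sub_inv_ne_zero {z : ℂ} (hz : 3 / 4 < z.im) :
    jacobiTheta (1 - 1 / z) ≠ 0 := by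
  have hz' : 0 < z.im := by linarith
  have hz0 : z ≠ 0 := by rintro rfl; simp at hz'
  have hx := exp_neg_pi_mul_lt hz
  set x := Real.exp (-π * z.im) with hxdef
  have hx0 : 0 < x := Real.exp_pos _
  have e1 : jacobiTheta (1 - 1 / z) = jacobiTheta₂ (1 / 2) (-1 / z) := by
    rw [jacobiTheta_eq_jacobiTheta₂]
    refine tsum_congr fun n ↦ ?_
    rw [jacobiTheta₂_term, jacobiTheta₂_term, Complex.exp_eq_exp_iff_exists_int]
    obtain ⟨k, hk⟩ := Int.even_mul_succ_self (n - 1)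
    refine ⟨k, ?_⟩
    have hk' : ((n : ℂ) - 1) * n = k + k := by
      have : (n - 1) * n = k + k := by rw [← hk]; ring
      exact_mod_cast this
    linear_combination (π * Complex.I) * hk'
  have e2 := jacobiTheta₂_functional_equation (z / 2) z
  rw [show z / 2 / z = 1 / 2 by field_simp, ← e1] at e2
  intro h0
  rw [h0, mul_zero] at e2
  have hs := (hasSum_jacobiTheta₂_term (z / 2) hz')
  rw [e2] at hs
  have hterm : ∀ n : ℤ, jacobiTheta₂_term n (z / 2) z =
      Complex.exp (π * Complex.I * ((n * (n + 1) : ℤ) : ℂ) * z) := by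
    intro n
    rw [jacobiTheta₂_term]
    congr 1
    push_cast
    ring
  have hs2 := hs.nat_add_neg_add_one
  have hsymm : ∀ n : ℕ, jacobiTheta₂_term n (z / 2) z + jacobiTheta₂_term (-(n + 1)) (z / 2) z =
      2 * jacobiTheta₂_term n (z / 2) z := by
    intro n
    rw [hterm, hterm, show (-((n : ℤ) + 1)) * (-((n : ℤ) + 1) + 1) = n * (n + 1) by ring, two_mul]
  simp_rw [hsymm] at hs2
  have hs3 : HasSum (fun n : ℕ ↦ jacobiTheta₂_term n (z / 2) z) 0 := by
    simpa using hs2.mul_left 2⁻¹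
  have hs4 := (hasSum_nat_add_iff' 1).mpr hs3
  rw [Finset.sum_range_one, hterm] at hs4
  simp only [Nat.cast_zero, zero_mul, Int.cast_zero, mul_zero, Complex.exp_zero, zero_sub] at hs4
  have hb : ∀ n : ℕ, ‖jacobiTheta₂_term ((n + 1 : ℕ) : ℤ) (z / 2) z‖ ≤ x * x ^ n := by
    intro n
    rw [hterm, Complex.norm_exp, ← pow_succ', hxdef, ← Real.exp_nat_mul, Real.exp_le_exp]
    have : (π * Complex.I * (((((n + 1 : ℕ) : ℤ) * (((n + 1 : ℕ) : ℤ) + 1) : ℤ)) : ℂ) * z).re =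
        -(π * z.im) * ((n + 1) * (n + 2)) := by
      push_cast
      simp
      ring
    rw [this]
    push_cast
    have hp : 0 < π * z.im := mul_pos Real.pi_pos hz'
    nlinarith [mul_nonneg hp.le (Nat.cast_nonneg (α := ℝ) n), sq_nonneg (n : ℝ),
      mul_nonneg hp.le (sq_nonneg (n : ℝ))]
  have := hs4.norm_le_of_bounded ((hasSum_geometric_of_lt_one hx0.le (by linarith)).mul_left x) hb
  rw [norm_neg, norm_one, ← div_eq_mul_inv, le_div_iff₀ (by linarith)] at this
  linarith

lemma thetaConstantsNeZero (τ : ℍ) : ThetaConstantsNeZero τ := by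
  obtain ⟨γ, hγ⟩ := ModularGroup.exists_smul_mem_fd τ
  rw [← thetaConstantsNeZero_smul γ]
  have him : 3 / 4 < ((γ • τ : ℍ) : ℂ).im := by
    have h := ModularGroup.three_le_four_mul_im_sq_of_mem_fd hγ
    have h0 := (γ • τ).im_pos
    rw [UpperHalfPlane.coe_im]
    nlinarith
  exact ⟨jacobiTheta_ne_zero_of_im him, jacobiTheta_ne_zero_of_im (by simpa using him),
    jacobiTheta_one_sub_inv_ne_zero him⟩

lemma theta_ne_zero (τ : ℍ) : theta τ ≠ 0 := by
  have := (thetaConstantsNeZero (dilate 2 τ)).1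
  simpa [theta, dilate] using this

end ThetaNeZero

/-! ### Transformation of θ and of η(24τ) -/

section Transformation

/-- Puts `γτ` into the shape required by the inversion formula at the rational point `b / d`, with
`σ = -(c + d / τ)`. -/
lemma coe_smul_of_pos (γ : SL(2, ℤ)) {d : ℕ} (hd : γ 1 1 = d) (hd0 : d ≠ 0) (τ : ℍ) :
    ((γ • τ : ℍ) : ℂ) = ((γ 0 1 : ℤ) - 1 / (-(γ 1 0 + d / τ))) / d := by
  have hdet := Matrix.SpecialLinearGroup.det_coe γ
  rw [Matrix.det_fin_two, hd] at hdet
  have hdet' : (γ 0 0 : ℂ) * d - (γ 0 1 : ℂ) * (γ 1 0 : ℂ) = 1 := by exact_mod_cast hdet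
  have hτ := τ.ne_zero
  have hdC : (d : ℂ) ≠ 0 := Nat.cast_ne_zero.mpr hd0
  have hden : (γ 1 0 : ℂ) * τ + d ≠ 0 := by
    have := UpperHalfPlane.denom_ne_zero γ τ
    simpa [UpperHalfPlane.denom, hd] using this
  have hden' : (τ : ℂ) * γ 1 0 + d ≠ 0 := by rwa [mul_comm]
  rw [UpperHalfPlane.specialLinearGroup_apply]
  simp only [eq_intCast, hd]
  have : -(γ 1 0 + d / τ : ℂ) = -((γ 1 0 * τ + d) / τ) := by field_simp
  rw [this]
  push_cast
  field_simp
  linear_combination (τ : ℂ) * hdet'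

lemma quadGauss_one (b : ℤ) : quadGauss 1 b = 1 := by
  rw [quadGauss]
  simp [Subsingleton.elim _ (0 : ZMod 1)]

lemma eta_neg_inv {σ : ℂ} (hσ : 0 < σ.im) :
    eta (-1 / σ) = (-Complex.I * σ) ^ (1 / 2 : ℂ) * eta σ := by
  have := eta_inversion (d := 1) (by norm_num) (b := 0) (b' := 0) (by norm_num) hσ
  simpa [quadGauss_one, neg_div] using this

lemma jacobiTheta_neg_inv_four {σ : ℂ} (hσ : 0 < σ.im) :
    jacobiTheta (2 * (-1 / (4 * σ))) =
      (√2 : ℝ) * (-Complex.I * σ) ^ (1 / 2 : ℂ) * jacobiTheta (2 * σ) := by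
  have := jacobiTheta_inversion (d := 1) (b := 0) (b' := 0) (by norm_num) (σ := 4 * σ)
    (by simpa using hσ)
  rw [show -Complex.I * (4 * σ) = ((4 : ℝ) : ℂ) * (-Complex.I * σ) by push_cast; ring,
    ofReal_mul_cpow_half (by norm_num)] at this
  have h4 : (√4 : ℝ) = √2 * √2 := by
    rw [Real.mul_self_sqrt (by norm_num), show (4 : ℝ) = 2 ^ 2 by norm_num,
      Real.sqrt_sq (by norm_num)]
  have h2 : ((√2 : ℝ) : ℂ) ≠ 0 := by simp
  rw [h4, quadGauss_one, show 4 * σ / 4 = σ by ring] at this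
  rw [show -1 / (4 * σ) = (((0 : ℤ) : ℂ) - 1 / (4 * σ)) / ((1 : ℕ) : ℂ) by
    push_cast; ring, this]
  push_cast
  simp only [add_zero, div_one, Real.sqrt_one, Complex.ofReal_one, mul_one]
  field_simp

lemma neg_add_div_im_pos {c : ℝ} {d : ℕ} (hd0 : d ≠ 0) (τ : ℍ) :
    0 < (-(c + d / τ) : ℂ).im := by
  have hd' : (0 : ℝ) < d := Nat.cast_pos.mpr (Nat.pos_of_ne_zero hd0)
  rw [show (-(c + d / τ) : ℂ) = ((d : ℝ) : ℂ) * (-1 / τ) - (c : ℝ) by push_cast; ring,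
    Complex.sub_im, Complex.im_ofReal_mul, Complex.ofReal_im, sub_zero]
  exact mul_pos hd' (im_neg_inv_pos τ.im_pos)

/-- Two inversions: at `b / d`, and then at 0. The determinant gives `4 b c ≡ -1` modulo `d`, so `b'
= c` is admissible, and the first inversion lands at `-1 / (4 τ)`. -/
lemma theta_smul_of_pos {γ : SL(2, ℤ)} {c : ℤ} (hc : γ 1 0 = 4 * c) {d : ℕ} [NeZero d]
    (hd : γ 1 1 = d) (τ : ℍ) :
    theta (γ • τ) = quadGauss d (γ 0 1) / (√d : ℝ) *
      (-Complex.I * -(γ 1 0 + d / τ)) ^ (1 / 2 : ℂ) * (-Complex.I * τ) ^ (1 / 2 : ℂ) *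
        theta τ := by
  have hdC : (d : ℂ) ≠ 0 := NeZero.ne _
  have hτ := τ.im_pos
  have hτ0 := τ.ne_zero
  have hdet := Matrix.SpecialLinearGroup.det_coe γ
  rw [Matrix.det_fin_two, hd, hc] at hdet
  set σ : ℂ := -(γ 1 0 + d / τ) with hσdef
  have hσ : 0 < σ.im := by
    have := neg_add_div_im_pos (c := (γ 1 0 : ℤ)) (NeZero.ne d) τ
    rwa [Complex.ofReal_intCast] at this
  have hγτ := coe_smul_of_pos γ hd (NeZero.ne d) τ
  rw [← hσdef] at hγτ
  have hc' : (γ 1 0 : ℂ) = 4 * c := by rw [hc]; push_cast; ring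
  have e3 : (σ / 4 + (c : ℂ)) / d = -1 / (4 * τ) := by
    rw [hσdef, hc']; field_simp; ring
  have hθ := jacobiTheta_inversion (b := γ 0 1) (b' := c) (d := d)
    ⟨γ 0 0, by linear_combination -hdet⟩ hσ
  rw [← hγτ, e3, jacobiTheta_neg_inv_four hτ] at hθ
  have h2 : (((√2 : ℝ)⁻¹ : ℝ) : ℂ) * (√2 : ℝ) = 1 := by
    rw [← Complex.ofReal_mul, inv_mul_cancel₀ (by positivity), Complex.ofReal_one]
  rw [theta, theta, hθ]
  linear_combination ((quadGauss d (γ 0 1) / (√d : ℝ)) *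
    (-Complex.I * σ) ^ (1 / 2 : ℂ) * (-Complex.I * τ) ^ (1 / 2 : ℂ) *
    jacobiTheta (2 * τ)) * h2

/-- The same two inversions for η, now with `576 b c ≡ -1` modulo `d`. Gauss sum and square roots
agree with those of θ, so comparing the two formulas leaves only χ₁₂(d). The factors `√(1 / 24)` and
`√24` of the two rescalings cancel. -/
lemma eta_smul_of_pos {γ : SL(2, ℤ)} (hγ : γ ∈ CongruenceSubgroup.Gamma0 576) {d : ℕ}
    (hd : γ 1 1 = d) (hd0 : d ≠ 0) (τ : ℍ) :
    eta (24 * ((γ • τ : ℍ) : ℂ)) * theta τ =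
      chiTwelve (d : ZMod 12) * theta (γ • τ) * eta (24 * (τ : ℂ)) := by
  have : NeZero d := ⟨hd0⟩
  have hdC : (d : ℂ) ≠ 0 := Nat.cast_ne_zero.mpr hd0
  have hτ := τ.im_pos
  have hτ0 := τ.ne_zero
  obtain ⟨c, hc⟩ := (ZMod.intCast_zmod_eq_zero_iff_dvd _ _).mp (CongruenceSubgroup.Gamma0_mem.mp hγ)
  have hdet := Matrix.SpecialLinearGroup.det_coe γ
  rw [Matrix.det_fin_two, hd, hc] at hdet
  push_cast at hdet hc
  have hcop : Nat.Coprime 12 d := by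
    rw [← Nat.isCoprime_iff_coprime]
    exact ⟨-48 * γ 0 1 * c, γ 0 0, by push_cast; linear_combination hdet⟩
  set σ : ℂ := -(γ 1 0 + d / τ) with hσdef
  have hσ : 0 < σ.im := by
    have := neg_add_div_im_pos (c := (γ 1 0 : ℤ)) hd0 τ
    rwa [Complex.ofReal_intCast] at this
  have hσ0 : σ ≠ 0 := by intro h; rw [h] at hσ; simp at hσ
  have hσ24 : 0 < (σ / 24).im := by simpa [Complex.div_im] using by positivity
  have hγτ := coe_smul_of_pos γ hd hd0 τ
  rw [← hσdef] at hγτ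
  have hc' : (γ 1 0 : ℂ) = 576 * c := by rw [hc]; push_cast; ring
  have e1 : 24 * ((γ • τ : ℍ) : ℂ) = (24 * (γ 0 1 : ℤ) - 1 / (σ / 24)) / d := by
    rw [hγτ]; field_simp
  have e2 : (σ / 24 + 24 * (c : ℤ)) / d = -1 / (24 * τ) := by
    rw [hσdef, hc']; field_simp; ring
  have h24 : 0 < (24 * (τ : ℂ)).im := by simpa using hτ
  have hη := eta_inversion hcop (b := γ 0 1) (b' := c) ⟨γ 0 0, by linear_combination -hdet⟩ hσ24
  have hθ := theta_smul_of_pos (c := 144 * c) (by rw [hc]; ring) hd τ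
  rw [← e1, e2, eta_neg_inv h24, show -Complex.I * (σ / 24) = ((1 / 24 : ℝ) : ℂ) *
    (-Complex.I * σ) by push_cast; ring, ofReal_mul_cpow_half (by norm_num),
    show -Complex.I * (24 * (τ : ℂ)) = ((24 : ℝ) : ℂ) * (-Complex.I * τ) by push_cast; ring,
    ofReal_mul_cpow_half (by norm_num)] at hη
  rw [← hσdef] at hθ
  have hs : ((√(1 / 24) : ℝ) : ℂ) * (√24 : ℝ) = 1 := by
    rw [← Complex.ofReal_mul, ← Real.sqrt_mul (by norm_num)]
    norm_num
  rw [hη, hθ]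
  linear_combination (chiTwelve (d : ZMod 12) * (quadGauss d (γ 0 1) / (√d : ℝ)) *
    (-Complex.I * σ) ^ (1 / 2 : ℂ) * (-Complex.I * τ) ^ (1 / 2 : ℂ) * eta (24 * τ) *
    theta τ) * hs

/-- The transformation of `η(24τ)` under `Γ₀(576)`. -/
theorem eta_smul {γ : SL(2, ℤ)} (hγ : γ ∈ CongruenceSubgroup.Gamma0 576) (τ : ℍ) :
    eta (24 * ((γ • τ : ℍ) : ℂ)) =
      chiTwelve (γ 1 1 : ZMod 12) * thetaFactor γ τ * eta (24 * (τ : ℂ)) := by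
  rw [thetaFactor]
  have hθ := theta_ne_zero τ
  rw [mul_div_assoc', div_mul_eq_mul_div, eq_div_iff hθ]
  have h0 : γ 1 1 ≠ 0 := by
    intro hd
    obtain ⟨c, hc⟩ :=
      (ZMod.intCast_zmod_eq_zero_iff_dvd _ _).mp (CongruenceSubgroup.Gamma0_mem.mp hγ)
    have hdet := Matrix.SpecialLinearGroup.det_coe γ
    rw [Matrix.det_fin_two, hd, hc] at hdet
    have : 576 * (γ 0 1 * c) = -1 := by push_cast at hdet; linear_combination -hdet
    omega
  obtain ⟨d, hd | hd⟩ := Int.eq_nat_or_neg (γ 1 1)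
  · have hd0 : d ≠ 0 := by rintro rfl; exact h0 (by simpa using hd)
    rw [eta_smul_of_pos hγ hd hd0, hd, Int.cast_natCast]
  -- For a negative lower right entry pass to `-γ`, which acts in the same way; χ₁₂ is even.
  · have hd0 : d ≠ 0 := by rintro rfl; exact h0 (by simpa using hd)
    have hγ' : -γ ∈ CongruenceSubgroup.Gamma0 576 := by
      rw [CongruenceSubgroup.Gamma0_mem] at hγ ⊢
      simpa using hγ
    have hd' : (-γ) 1 1 = d := by simp [hd]
    have := eta_smul_of_pos hγ' hd' hd0 τ
    rw [ModularGroup.SL_neg_smul] at this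
    rw [this, hd, Int.cast_neg, chiTwelve_neg, Int.cast_natCast]

end Transformation

/-! ### Fourth powers of quadratic Gauss sums -/

section GaussFourthPower

/-- In the double sum the substitution `x = u + y` cancels `y²`; the sum over `y` is then linear and
forces `u = 0`. -/
lemma quadGauss_mul_neg {d : ℕ} [NeZero d] (hd : Odd d) {b : ℤ} (hb : IsUnit (b : ZMod d)) :
    quadGauss d b * quadGauss d (-b) = d := by
  have h2 : IsUnit (2 : ZMod d) := by
    have := (ZMod.isUnit_iff_coprime 2 d).mpr (Nat.coprime_two_left.mpr hd)
    simpa using this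
  rw [quadGauss, quadGauss, Finset.sum_mul_sum, Finset.sum_comm]
  have h1 : ∀ y : ZMod d, ∑ x : ZMod d, ZMod.stdAddChar ((b : ZMod d) * x ^ 2) *
      ZMod.stdAddChar (((-b : ℤ) : ZMod d) * y ^ 2) =
      ∑ u : ZMod d, ZMod.stdAddChar ((b : ZMod d) * u ^ 2) *
        ZMod.stdAddChar (y * (2 * (b : ZMod d) * u)) := by
    intro y
    rw [← Equiv.sum_comp (Equiv.addRight y)]
    refine Finset.sum_congr rfl fun u _ ↦ ?_
    rw [← AddChar.map_add_eq_mul, ← AddChar.map_add_eq_mul]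
    congr 1
    simp only [Equiv.coe_addRight, Int.cast_neg]
    ring
  simp_rw [h1]
  rw [Finset.sum_comm]
  simp_rw [← Finset.mul_sum, AddChar.sum_mulShift _ (ZMod.isPrimitive_stdAddChar d),
    (h2.mul hb).mul_right_eq_zero]
  simp [ZMod.card]

/-- The square is a sum over the norm form `x² + y²`, and multiplication by `p + q i` permutes the
pairs modulo `d` while scaling the norm by `p² + q²`. -/
lemma quadGauss_sq_eq_of_sq_add_sq {d : ℕ} [NeZero d] {p q : ℤ}
    (h : IsUnit ((p ^ 2 + q ^ 2 : ℤ) : ZMod d)) (b : ℤ) :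
    quadGauss d ((p ^ 2 + q ^ 2) * b) ^ 2 = quadGauss d b ^ 2 := by
  have hsq : ∀ b : ℤ, quadGauss d b ^ 2 =
      ∑ x : ZMod d × ZMod d, ZMod.stdAddChar ((b : ZMod d) * (x.1 ^ 2 + x.2 ^ 2)) := by
    intro b
    rw [quadGauss, pow_two, Finset.sum_mul_sum, ← Finset.univ_product_univ, Finset.sum_product]
    refine Finset.sum_congr rfl fun x _ ↦ Finset.sum_congr rfl fun y _ ↦ ?_
    rw [← AddChar.map_add_eq_mul, mul_add]
  have hinj : Function.Injective fun x : ZMod d × ZMod d ↦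
      ((p : ZMod d) * x.1 - q * x.2, (q : ZMod d) * x.1 + p * x.2) := by
    rintro ⟨x, y⟩ ⟨x', y'⟩ hxy
    simp only [Prod.mk.injEq] at hxy
    obtain ⟨h1, h2⟩ := hxy
    push_cast at h
    refine Prod.ext (h.mul_left_cancel ?_) (h.mul_left_cancel ?_)
    · linear_combination (p : ZMod d) * h1 + q * h2
    · linear_combination (p : ZMod d) * h2 - q * h1
  rw [hsq, hsq]
  refine Eq.trans (Finset.sum_congr rfl fun x _ ↦ ?_)
    ((Finite.injective_iff_bijective.mp hinj).sum_comp fun x ↦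
      ZMod.stdAddChar ((b : ZMod d) * (x.1 ^ 2 + x.2 ^ 2)))
  congr 1
  push_cast
  ring

/-- The quadratic Gauss sum of an odd modulus `d` is a fourth root of unity times `√d`. -/
theorem quadGauss_pow_four {d : ℕ} [NeZero d] (hd : Odd d) {b : ℤ} (hb : IsUnit (b : ZMod d)) :
    quadGauss d b ^ 4 = (d : ℂ) ^ 2 := by
  have hcop : Nat.Coprime 4 d :=
    Nat.Coprime.pow_left 2 (Nat.coprime_two_left.mpr hd)
  have : NeZero (4 * d) := ⟨mul_ne_zero (by norm_num) (NeZero.ne d)⟩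
  -- By Dirichlet there is a prime `P ≡ 1` modulo 4 with `P ≡ -1` modulo `d`. It is a sum of two
  -- squares, so `-1` is one modulo `d`, and the sums for `b` and `-b` have equal squares; their
  -- product is `d`.
  obtain ⟨a, ha4, had⟩ := Nat.chineseRemainder hcop 1 (d - 1)
  have hd1 : 1 ≤ d := NeZero.one_le
  have had' : (a : ZMod d) = -1 := by
    rw [(ZMod.natCast_eq_natCast_iff _ _ _).mpr had, Nat.cast_sub hd1]; simp
  have hau : IsUnit (a : ZMod (4 * d)) := by
    rw [ZMod.isUnit_iff_coprime]
    refine Nat.Coprime.mul_right ?_ ?_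
    · rw [← ZMod.isUnit_iff_coprime, (ZMod.natCast_eq_natCast_iff _ _ _).mpr ha4]; simp
    · rw [← ZMod.isUnit_iff_coprime, had']; exact isUnit_one.neg
  obtain ⟨P, -, hP, hPa⟩ := Nat.forall_exists_prime_gt_and_eq_mod hau 0
  have hPa' := (ZMod.natCast_eq_natCast_iff _ _ _).mp hPa
  have hP4 : P ≡ 1 [MOD 4] := (hPa'.of_mul_right d).trans ha4
  have hPd : (P : ZMod d) = -1 := by
    rw [(ZMod.natCast_eq_natCast_iff _ _ _).mpr (hPa'.of_mul_left 4), had']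
  have : Fact P.Prime := ⟨hP⟩
  obtain ⟨p, q, hpq⟩ := Nat.Prime.sq_add_sq (p := P) (by rw [hP4]; norm_num)
  have hpqd : (((p : ℤ) ^ 2 + (q : ℤ) ^ 2 : ℤ) : ZMod d) = -1 := by
    rw [← hPd, ← hpq]; push_cast; rfl
  have h := quadGauss_sq_eq_of_sq_add_sq (d := d) (p := p) (q := q)
    (by rw [hpqd]; exact isUnit_one.neg) b
  have e : quadGauss d (((p : ℤ) ^ 2 + (q : ℤ) ^ 2) * b) = quadGauss d (-b) := by
    rw [quadGauss, quadGauss]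
    refine Finset.sum_congr rfl fun x _ ↦ ?_
    rw [Int.cast_mul, hpqd, Int.cast_neg, neg_one_mul]
  rw [e] at h
  rw [← quadGauss_mul_neg hd hb]
  linear_combination (-quadGauss d b ^ 2) * h

end GaussFourthPower

/-! ### The fourth power of the theta automorphy factor -/

section ThetaFactor

lemma cpow_half_sq (z : ℂ) : (z ^ (1 / 2 : ℂ)) ^ 2 = z := by
  rw [← Complex.cpow_nat_mul]; simp

lemma thetaFactor_pow_four_of_pos {γ : SL(2, ℤ)} {c : ℤ} (hc : γ 1 0 = 4 * c) {d : ℕ}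
    [NeZero d] (hd : γ 1 1 = d) (τ : ℍ) :
    thetaFactor γ τ ^ 4 = ((γ 1 0 : ℂ) * τ + γ 1 1) ^ 2 := by
  have hdet := Matrix.SpecialLinearGroup.det_coe γ
  rw [Matrix.det_fin_two, hd, hc] at hdet
  have hodd : Odd d := by
    by_contra h
    obtain ⟨e, he⟩ := Nat.not_odd_iff_even.mp h
    rw [he] at hdet
    have : 2 * (γ 0 0 * e - γ 0 1 * 2 * c) = 1 := by push_cast at hdet; linear_combination hdet
    omega
  have hb : IsUnit ((γ 0 1 : ℤ) : ZMod d) := by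
    refine IsUnit.of_mul_eq_one (-(4 * c : ℤ) : ZMod d) ?_
    have := congrArg (Int.cast : ℤ → ZMod d) hdet
    push_cast at this ⊢
    rw [ZMod.natCast_self] at this
    linear_combination this
  have hθ := theta_ne_zero τ
  have hτ0 := τ.ne_zero
  have hdC : (d : ℂ) ≠ 0 := NeZero.ne _
  rw [thetaFactor, theta_smul_of_pos hc hd, mul_div_cancel_right₀ _ hθ, mul_pow, mul_pow, div_pow,
    quadGauss_pow_four hodd hb]
  rw [show (4 : ℕ) = 2 * 2 from rfl, pow_mul (Complex.ofReal _), pow_mul _ 2 2, pow_mul _ 2 2,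
    cpow_half_sq, cpow_half_sq, ← Complex.ofReal_pow, Real.sq_sqrt (Nat.cast_nonneg _),
    Complex.ofReal_natCast, div_self (pow_ne_zero 2 hdC), one_mul, ← mul_pow, hd]
  congr 1
  field_simp
  linear_combination (-((γ 1 0 : ℂ) * τ + d)) * Complex.I_sq

theorem thetaFactor_pow_four {γ : SL(2, ℤ)} {c : ℤ} (hc : γ 1 0 = 4 * c) (τ : ℍ) :
    thetaFactor γ τ ^ 4 = ((γ 1 0 : ℂ) * τ + γ 1 1) ^ 2 := by
  have h0 : γ 1 1 ≠ 0 := by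
    intro hd
    have hdet := Matrix.SpecialLinearGroup.det_coe γ
    rw [Matrix.det_fin_two, hd, hc] at hdet
    have : 4 * (γ 0 1 * c) = -1 := by linear_combination -hdet
    omega
  obtain ⟨d, hd | hd⟩ := Int.eq_nat_or_neg (γ 1 1)
  · have : NeZero d := ⟨by rintro rfl; exact h0 (by simpa using hd)⟩
    exact thetaFactor_pow_four_of_pos hc hd τ
  · have : NeZero d := ⟨by rintro rfl; exact h0 (by simpa using hd)⟩
    have hd' : (-γ) 1 1 = d := by simp [hd]
    have hc' : (-γ) 1 0 = 4 * -c := by simp [hc]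
    have := thetaFactor_pow_four_of_pos hc' hd' τ
    rw [thetaFactor, ModularGroup.SL_neg_smul] at this
    rw [thetaFactor, this]
    simp only [Matrix.SpecialLinearGroup.coe_neg, Matrix.neg_apply]
    push_cast
    ring

end ThetaFactor

/-! ### Dilation by d and the slash action -/

section LevelRaising

lemma coe_dilate (d : ℕ) [NeZero d] (τ : ℍ) : (dilate d τ : ℂ) = d * τ := rfl

/-- The matrix `(d 0; 0 1)`. -/
def dilateMatrix (d : ℕ) [NeZero d] : GL (Fin 2) ℝ :=
  Matrix.GeneralLinearGroup.mkOfDetNeZero !![(d : ℝ), 0; 0, 1] (by simp [NeZero.ne d])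

lemma dilateMatrix_smul (d : ℕ) [NeZero d] (τ : ℍ) : dilateMatrix d • τ = dilate d τ := by
  have hdet : 0 < (dilateMatrix d).det.val := by
    simpa [dilateMatrix, Matrix.GeneralLinearGroup.mkOfDetNeZero] using NeZero.pos d
  ext
  rw [UpperHalfPlane.coe_smul_of_det_pos hdet, coe_dilate]
  simp [UpperHalfPlane.num, UpperHalfPlane.denom, dilateMatrix,
    Matrix.GeneralLinearGroup.mkOfDetNeZero]

/-- A rational matrix takes ∞ to ∞ or to a rational point, so growth of a level one form at its
cusps also controls its dilation at every cusp. -/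
lemma isCusp_dilateMatrix_mul_smul (d : ℕ) [NeZero d] (α : SL(2, ℤ)) :
    IsCusp ((dilateMatrix d * Matrix.SpecialLinearGroup.mapGL ℝ α) • OnePoint.infty) 𝒮ℒ := by
  rw [isCusp_SL2Z_iff, OnePoint.smul_infty_eq_ite]
  split_ifs
  · exact ⟨OnePoint.infty, rfl⟩
  · refine ⟨((d * α 0 0 / α 1 0 : ℚ) : OnePoint ℚ), ?_⟩
    rw [OnePoint.map_some]
    simp [dilateMatrix, Matrix.GeneralLinearGroup.mkOfDetNeZero, Matrix.mul_apply,
      Fin.sum_univ_two]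

lemma slash_dilateMatrix_mul {w : ℤ} (f : ℍ → ℂ) (d : ℕ) [NeZero d] (α : SL(2, ℤ)) (τ : ℍ) :
    (f ∣[w] (dilateMatrix d * Matrix.SpecialLinearGroup.mapGL ℝ α)) τ =
      (d : ℂ) ^ (w - 1) * (f (dilate d (α • τ)) * (α 1 0 * (τ : ℂ) + α 1 1) ^ (-w)) := by
  have hdet : 0 < (dilateMatrix d * Matrix.SpecialLinearGroup.mapGL ℝ α).det.val := by
    simpa [dilateMatrix, Matrix.GeneralLinearGroup.mkOfDetNeZero] using NeZero.pos d
  rw [ModularForm.slash_apply, UpperHalfPlane.σ, if_pos hdet, mul_smul, dilateMatrix_smul]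
  simp [UpperHalfPlane.denom, dilateMatrix, Matrix.GeneralLinearGroup.mkOfDetNeZero,
    Matrix.mul_apply, Fin.sum_univ_two]
  rw [mul_comm (f _), mul_assoc]
  rfl

end LevelRaising

/-! ### η(24τ)^r F(24τ) is a nonzero cusp form -/

section CuspForm

/-- The function `η(24τ)^r F(24τ)` is holomorphic. -/
lemma mdifferentiable_etaTwist (r : ℕ) {m : ℤ} (F : ModularForm 𝒮ℒ m) :
    MDifferentiable 𝓘(ℂ) 𝓘(ℂ) (etaTwist r F) := by
  rw [UpperHalfPlane.mdifferentiable_iff]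
  have hF := UpperHalfPlane.mdifferentiable_iff.mp F.holo'
  have h24 : ∀ z : ℂ, 0 < z.im → 0 < (24 * z).im := fun z hz ↦ by simpa using hz
  have h1 : DifferentiableOn ℂ (fun z ↦ eta (24 * z) ^ r * ((F : ℍ → ℂ) ∘ ofComplex) (24 * z))
      {z | 0 < z.im} := by
    refine DifferentiableOn.mul (fun z hz ↦ ?_) (hF.comp (by fun_prop) h24)
    exact (((differentiableAt_eta_of_mem_upperHalfPlaneSet (h24 z hz)).comp z
      (by fun_prop)).pow r).differentiableWithinAt
  refine h1.congr fun z hz ↦ ?_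
  simp only [Function.comp_apply, etaTwist, ofComplex_apply_of_im_pos hz,
    ofComplex_apply_of_im_pos (h24 z hz), dilate]
  rfl

lemma isZeroAtImInfty_of_norm_pow_eq {f g : ℍ → ℂ} {n : ℕ} (hn : n ≠ 0) {C : ℝ}
    (hg : IsZeroAtImInfty g) (h : ∀ τ, ‖f τ‖ ^ n = C * ‖g τ‖) : IsZeroAtImInfty f := by
  rw [IsZeroAtImInfty, Filter.ZeroAtFilter, tendsto_zero_iff_norm_tendsto_zero] at hg ⊢
  have h1 := (hg.const_mul C).rpow_const (p := (n : ℝ)⁻¹) (Or.inr (by positivity))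
  simp_rw [← h, Real.pow_rpow_inv_natCast (norm_nonneg _) hn] at h1
  simpa [Real.zero_rpow, hn] using h1

/-- After taking absolute values and 24th powers, the multiplier and the choice of `φ` disappear,
and the function becomes a slash of `Δ^r F^24`, where Δ vanishes at every cusp and F is bounded. -/
lemma isZeroAtImInfty_halfSlash {r m : ℕ} (hr : Odd r) (F : ModularForm 𝒮ℒ (m : ℤ))
    {α : SL(2, ℤ)} {φ : ℍ → ℂ} (hφ : IsShimuraPair α φ) :
    IsZeroAtImInfty (halfSlash (m + (r - 1) / 2) (etaTwist r F) α φ) := by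
  obtain ⟨-, s, hs, hφs⟩ := hφ
  have hr0 : r ≠ 0 := by rintro rfl; simp at hr
  set g := dilateMatrix 24 * Matrix.SpecialLinearGroup.mapGL ℝ α with hg
  have hΔ := CuspForm.discriminant.zero_at_cusps' (isCusp_dilateMatrix_mul_smul 24 α) g rfl
  have hF := F.bdd_at_cusps' (isCusp_dilateMatrix_mul_smul 24 α) g rfl
  have hΔr : ∀ n : ℕ, IsZeroAtImInfty ((CuspForm.discriminant.toFun ∣[(12 : ℤ)] g) ^ (n + 1)) := by
    intro n
    induction n with
    | zero => simpa using hΔ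
    | succ n ih =>
      rw [pow_succ]
      exact ih.mul_boundedAtFilter hΔ.boundedAtFilter
  have hFn : ∀ n : ℕ, IsBoundedAtImInfty ((F.toFun ∣[(m : ℤ)] g) ^ n) := by
    intro n
    induction n with
    | zero => exact Filter.const_boundedAtFilter _ 1
    | succ n ih =>
      rw [pow_succ]
      exact ih.mul hF
  have hz := (hΔr (r - 1)).mul_boundedAtFilter (hFn 24)
  rw [Nat.sub_add_cancel (Nat.pos_of_ne_zero hr0)] at hz
  -- `C` removes the powers `24^(w - 1)` that the slash operator attaches to the determinant 24: `w
  -- = 12` taken `r` times and `w = m` taken 24 times.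
  refine isZeroAtImInfty_of_norm_pow_eq (n := 24) (by norm_num) hz
    (C := ((24 : ℝ) ^ (11 * r))⁻¹ * ((24 : ℝ) ^ (((m : ℤ) - 1) * 24))⁻¹) fun τ ↦ ?_
  rw [Pi.mul_apply, Pi.pow_apply, Pi.pow_apply, hg, slash_dilateMatrix_mul,
    slash_dilateMatrix_mul, halfSlash, etaTwist]
  set j : ℂ := α 1 0 * (τ : ℂ) + α 1 1 with hj
  have hj0 : j ≠ 0 := by
    have := UpperHalfPlane.denom_ne_zero α τ
    simpa [UpperHalfPlane.denom] using this
  have hφn : ‖φ τ‖ ^ 2 = ‖j‖ := by rw [← norm_pow, hφs, norm_mul, hs, one_mul]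
  have hk : 24 * (2 * (m + (r - 1) / 2) + 1) = 2 * (12 * r + 24 * m) := by
    obtain ⟨t, rfl⟩ := hr
    omega
  have e1 : CuspForm.discriminant.toFun (dilate 24 (α • τ)) =
      eta (24 * ((α • τ : ℍ) : ℂ)) ^ 24 := rfl
  have e2 : F.toFun (dilate 24 (α • τ)) = F (dilate 24 (α • τ)) := rfl
  rw [e1, e2]
  simp only [norm_mul, norm_pow, norm_inv, norm_zpow, mul_pow, inv_pow]
  rw [← pow_mul, ← pow_mul, ← pow_mul, mul_comm _ 24, hk, pow_mul ‖φ τ‖, hφn]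
  have h24 : ‖((24 : ℕ) : ℂ)‖ = 24 := by norm_num
  have hn0 : ‖j‖ ≠ 0 := norm_ne_zero_iff.mpr hj0
  rw [h24, zpow_neg, zpow_neg, zpow_natCast, show ((12 : ℤ) - 1) = ((11 : ℕ) : ℤ) by norm_num,
    zpow_natCast, ← pow_mul 24, zpow_mul, show (24 : ℤ) = ((24 : ℕ) : ℤ) from rfl, zpow_natCast,
    show (12 : ℤ) = ((12 : ℕ) : ℤ) from rfl, zpow_natCast, pow_add, inv_pow, inv_pow, ← pow_mul ‖j‖,
    ← pow_mul ‖j‖, mul_comm m 24, mul_comm r 24]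
  field_simp

/-- `24 γτ` is the image of `24 τ` under a matrix with the same denominator. -/
lemma exists_dilate_smul {γ : SL(2, ℤ)} {d : ℕ} [NeZero d] {c : ℤ} (hc : γ 1 0 = d * c) :
    ∃ γ' : SL(2, ℤ), ∀ τ : ℍ, dilate d (γ • τ) = γ' • dilate d τ ∧
      UpperHalfPlane.denom γ' (dilate d τ) = γ 1 0 * τ + γ 1 1 := by
  have hdet := Matrix.SpecialLinearGroup.det_coe γ
  rw [Matrix.det_fin_two, hc] at hdet
  obtain ⟨γ', h00, h01, h10, h11⟩ : ∃ γ' : SL(2, ℤ), γ' 0 0 = γ 0 0 ∧ γ' 0 1 = d * γ 0 1 ∧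
      γ' 1 0 = c ∧ γ' 1 1 = γ 1 1 :=
    ⟨⟨!![γ 0 0, d * γ 0 1; c, γ 1 1], by rw [Matrix.det_fin_two_of]; linear_combination hdet⟩,
      rfl, rfl, rfl, rfl⟩
  refine ⟨γ', fun τ ↦ ⟨?_, ?_⟩⟩
  · apply UpperHalfPlane.ext
    rw [coe_dilate, UpperHalfPlane.coe_specialLinearGroup_apply,
      UpperHalfPlane.coe_specialLinearGroup_apply, coe_dilate, h00, h01, h10, h11, hc]
    simp only [algebraMap_int_eq, eq_intCast, Complex.ofReal_intCast, Int.cast_mul,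
      Int.cast_natCast, Complex.ofReal_mul, Complex.ofReal_natCast]
    ring
  · simp [UpperHalfPlane.denom, hc, h10, h11, coe_dilate]
    ring

lemma chiTwelve_pow_odd {r : ℕ} (hr : Odd r) (x : ZMod 12) : chiTwelve x ^ r = chiTwelve x := by
  have h : ∀ x, chiTwelveInt x = 1 ∨ chiTwelveInt x = -1 ∨ chiTwelveInt x = 0 := by decide
  rw [chiTwelve_apply]
  rcases h x with h | h | h <;> rw [h]
  · simp
  · simp [hr.neg_one_pow]
  · simp [hr.pos.ne']

lemma chiTwelve576_intCast {d : ℤ} (hd : IsCoprime d (576 : ℕ)) :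
    chiTwelve576 (d : ZMod 576) = chiTwelve (d : ZMod 12) := by
  rw [chiTwelve576, DirichletCharacter.changeLevel_eq_cast_of_dvd' _ _ hd]

/-- With `m = 2 n`, the weight `m` factor of F is a power of (cτ + d)², that is j^(4n); oddness of
`r` gives χ₁₂^r = χ₁₂ and `2 k + 1 = r + 2 m`. -/
lemma etaTwist_smul {r m : ℕ} (hr : Odd r) (hm : Even m) (F : ModularForm 𝒮ℒ (m : ℤ))
    {γ : SL(2, ℤ)} (hγ : γ ∈ CongruenceSubgroup.Gamma0 576) (τ : ℍ) :
    etaTwist r F (γ • τ) = chiTwelve576 ((γ 1 1 : ℤ) : ZMod 576) *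
      thetaFactor γ τ ^ (2 * (m + (r - 1) / 2) + 1) * etaTwist r F τ := by
  obtain ⟨c, hc⟩ := (ZMod.intCast_zmod_eq_zero_iff_dvd _ _).mp (CongruenceSubgroup.Gamma0_mem.mp hγ)
  push_cast at hc
  have hu : IsCoprime (γ 1 1) (576 : ℕ) := by
    have hdet := Matrix.SpecialLinearGroup.det_coe γ
    rw [Matrix.det_fin_two, hc] at hdet
    exact ⟨γ 0 0, -(γ 0 1 * c), by push_cast; linear_combination hdet⟩
  obtain ⟨γ', hγ'⟩ := exists_dilate_smul (d := 24) (γ := γ) (c := 24 * c) (by rw [hc]; push_cast; ring)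
  obtain ⟨n, rfl⟩ := hm
  have hF := SlashInvariantForm.slash_action_eqn'' (Γ := 𝒮ℒ) F
    (γ := Matrix.SpecialLinearGroup.mapGL ℝ γ') ⟨γ', rfl⟩ (dilate 24 τ)
  rw [etaTwist, (hγ' τ).1, eta_smul hγ, mul_pow, mul_pow, chiTwelve_pow_odd hr,
    chiTwelve576_intCast hu, etaTwist]
  have hF' : F (γ' • dilate 24 τ) = thetaFactor γ τ ^ (4 * n) * F (dilate 24 τ) := by
    refine hF.trans ?_
    rw [pow_mul, thetaFactor_pow_four (c := 144 * c) (by rw [hc]; ring), ← (hγ' τ).2, ← pow_mul,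
      zpow_natCast, two_mul]
    rfl
  have he : 2 * (n + n + (r - 1) / 2) + 1 = r + 4 * n := by
    obtain ⟨t, rfl⟩ := hr
    omega
  rw [hF', he, pow_add]
  ring

theorem isCuspForm_etaTwist {r m : ℕ} (hr : Odd r) (hm : Even m) (F : ModularForm 𝒮ℒ (m : ℤ)) :
    IsCuspForm (m + (r - 1) / 2) 576 chiTwelve576 (etaTwist r F) where
  holo := mdifferentiable_etaTwist r F
  transform _ hγ τ := etaTwist_smul hr hm F hγ τ
  zero_at_cusps _ _ hφ := isZeroAtImInfty_halfSlash hr F hφ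

lemma etaTwist_ne_zero (r : ℕ) {m : ℤ} {F : ModularForm 𝒮ℒ m} (hF : F ≠ 0) :
    etaTwist r F ≠ 0 := by
  obtain ⟨z, hz⟩ := DFunLike.ne_iff.mp hF
  intro h
  have hz24 : 0 < ((z : ℂ) / 24).im := by simpa [Complex.div_im] using z.im_pos
  have hd : dilate 24 ⟨(z : ℂ) / 24, hz24⟩ = z := by
    ext; rw [coe_dilate]; push_cast; exact mul_div_cancel₀ _ (by norm_num)
  have := congrFun h ⟨(z : ℂ) / 24, hz24⟩
  rw [etaTwist, hd] at this
  have h1 := eta_ne_zero (show (24 * ((z : ℂ) / 24)) ∈ upperHalfPlaneSet by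
    rw [mul_div_cancel₀ _ (by norm_num)]; exact z.im_pos)
  exact mul_ne_zero (pow_ne_zero _ h1) hz this

end CuspForm

/-! ### Gauss sums modulo ℓ and ℓ² -/

section LegendreGauss

variable (ℓ : ℕ) [Fact ℓ.Prime]

/-- The Legendre symbol as a complex-valued character. -/
def legendreChar : MulChar (ZMod ℓ) ℂ :=
  (quadraticChar (ZMod ℓ)).ringHomComp (Int.castRingHom ℂ)

lemma legendreChar_apply (x : ZMod ℓ) : legendreChar ℓ x = (quadraticChar (ZMod ℓ) x : ℂ) := rfl

lemma legendreChar_intCast (a : ℤ) : legendreChar ℓ (a : ZMod ℓ) = (legendreSym ℓ a : ℂ) := rfl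

lemma legendreChar_isQuadratic : (legendreChar ℓ).IsQuadratic :=
  (quadraticChar_isQuadratic _).comp _

variable {ℓ}

lemma legendreChar_sq {x : ZMod ℓ} (hx : x ≠ 0) : legendreChar ℓ x ^ 2 = 1 := by
  rw [legendreChar_apply]
  exact_mod_cast quadraticChar_sq_one hx

lemma ringChar_zmod_ne_two (hℓ : ℓ ≠ 2) : ringChar (ZMod ℓ) ≠ 2 := by
  rwa [ZMod.ringChar_zmod_n]

lemma legendreChar_ne_one (hℓ : ℓ ≠ 2) : legendreChar ℓ ≠ 1 :=
  (MulChar.ringHomComp_ne_one_iff (RingHom.injective_int _)).mpr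
    (quadraticChar_ne_one (ringChar_zmod_ne_two hℓ))

variable (ℓ) in
/-- The Gauss sum of the Legendre symbol. -/
def legendreGauss : ℂ := gaussSum (legendreChar ℓ) (ZMod.stdAddChar (N := ℓ))

lemma legendreGauss_sq (hℓ : ℓ ≠ 2) : legendreGauss ℓ ^ 2 = legendreChar ℓ (-1) * ℓ := by
  rw [legendreGauss, gaussSum_sq (χ := legendreChar ℓ) (legendreChar_ne_one hℓ)
    (legendreChar_isQuadratic ℓ) (ZMod.isPrimitive_stdAddChar ℓ), ZMod.card]

lemma sum_legendreChar_mul (hℓ : ℓ ≠ 2) (n : ZMod ℓ) :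
    ∑ b : ZMod ℓ, legendreChar ℓ b * ZMod.stdAddChar (n * b) =
      legendreChar ℓ n * legendreGauss ℓ := by
  by_cases hn : n = 0
  · subst hn
    rw [MulChar.map_zero]
    simpa using MulChar.sum_eq_zero_of_ne_one (legendreChar_ne_one hℓ)
  · have := gaussSum_mulShift_eq (legendreChar ℓ) (ZMod.stdAddChar (N := ℓ)) (Units.mk0 n hn)
    rw [(legendreChar_isQuadratic ℓ).inv] at this
    exact this

/-- A residue `y` has `1 + (y / ℓ)` square roots, and the constant 1 contributes a vanishing
character sum. -/
lemma quadGauss_prime (hℓ : ℓ ≠ 2) {b : ℤ} (hb : (b : ZMod ℓ) ≠ 0) :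
    quadGauss ℓ b = legendreChar ℓ (b : ZMod ℓ) * legendreGauss ℓ := by
  classical
  have h1 : ∀ y : ZMod ℓ, (∑ x : ZMod ℓ with x ^ 2 = y, ZMod.stdAddChar ((b : ZMod ℓ) * x ^ 2) : ℂ)
      = (legendreChar ℓ y + 1) * ZMod.stdAddChar ((b : ZMod ℓ) * y) := by
    intro y
    rw [Finset.sum_congr rfl (g := fun _ ↦ ZMod.stdAddChar ((b : ZMod ℓ) * y))
      (fun x hx ↦ by rw [(Finset.mem_filter.mp hx).2]), Finset.sum_const, nsmul_eq_mul]
    congr 1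
    have h := quadraticChar_card_sqrts (ringChar_zmod_ne_two hℓ) y
    rw [legendreChar_apply]
    have h2 : ({x : ZMod ℓ | x ^ 2 = y} : Set (ZMod ℓ)).toFinset =
        Finset.univ.filter (fun x : ZMod ℓ ↦ x ^ 2 = y) := by ext; simp
    rw [h2] at h
    exact_mod_cast h
  rw [quadGauss, ← Finset.sum_fiberwise (s := Finset.univ) (g := fun x : ZMod ℓ ↦ x ^ 2)]
  simp_rw [h1, add_mul, one_mul]
  rw [Finset.sum_add_distrib, sum_legendreChar_mul hℓ]
  simp_rw [mul_comm (b : ZMod ℓ)]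
  rw [AddChar.sum_mulShift _ (ZMod.isPrimitive_stdAddChar ℓ), if_neg hb]
  simp

/-- Averaging over the shifts `x ↦ x + ℓ t` kills all `x` with `ℓ x ≠ 0`, and on the others the
phase is 1. The sum is thus a natural number, and its fourth power, already known to be `ℓ⁴`,
determines it. -/
lemma quadGauss_prime_sq (hℓ : ℓ ≠ 2) [NeZero (ℓ ^ 2)] {b : ℤ} (hb : IsUnit (b : ZMod (ℓ ^ 2))) :
    quadGauss (ℓ ^ 2) b = ℓ := by
  classical
  have hodd : Odd (ℓ ^ 2) := ((Fact.out : ℓ.Prime).odd_of_ne_two hℓ).pow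
  have h2 : IsUnit (2 : ZMod (ℓ ^ 2)) := by
    have := (ZMod.isUnit_iff_coprime 2 (ℓ ^ 2)).mpr (Nat.coprime_two_left.mpr hodd)
    simpa using this
  have hℓ2 : (ℓ : ZMod (ℓ ^ 2)) ^ 2 = 0 := by
    have := ZMod.natCast_self (ℓ ^ 2)
    rwa [Nat.cast_pow] at this
  have hN : ((ℓ ^ 2 : ℕ) : ℂ) ≠ 0 := NeZero.ne _
  have key : ((ℓ ^ 2 : ℕ) : ℂ) * quadGauss (ℓ ^ 2) b = ((ℓ ^ 2 : ℕ) : ℂ) *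
      ((Finset.univ.filter fun x : ZMod (ℓ ^ 2) ↦ (ℓ : ZMod (ℓ ^ 2)) * x = 0).card : ℂ) := by
    have e1 : ((ℓ ^ 2 : ℕ) : ℂ) * quadGauss (ℓ ^ 2) b = ∑ t : ZMod (ℓ ^ 2), ∑ x : ZMod (ℓ ^ 2),
        ZMod.stdAddChar ((b : ZMod (ℓ ^ 2)) * (x + (ℓ : ZMod (ℓ ^ 2)) * t) ^ 2) := by
      have : ∀ t : ZMod (ℓ ^ 2), ∑ x : ZMod (ℓ ^ 2),
          ZMod.stdAddChar ((b : ZMod (ℓ ^ 2)) * (x + (ℓ : ZMod (ℓ ^ 2)) * t) ^ 2) = quadGauss (ℓ ^ 2) b :=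
        fun t ↦ Equiv.sum_comp (Equiv.addRight ((ℓ : ZMod (ℓ ^ 2)) * t))
          (fun x ↦ ZMod.stdAddChar ((b : ZMod (ℓ ^ 2)) * x ^ 2))
      simp_rw [this]
      rw [Finset.sum_const, Finset.card_univ, ZMod.card, nsmul_eq_mul]
    have e2 : ∀ x t : ZMod (ℓ ^ 2), (ZMod.stdAddChar ((b : ZMod (ℓ ^ 2)) * (x + (ℓ : ZMod (ℓ ^ 2)) * t) ^ 2) : ℂ) =
        ZMod.stdAddChar ((b : ZMod (ℓ ^ 2)) * x ^ 2) *
          ZMod.stdAddChar (t * (2 * (b : ZMod (ℓ ^ 2)) * ((ℓ : ZMod (ℓ ^ 2)) * x))) := by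
      intro x t
      rw [← AddChar.map_add_eq_mul]
      congr 1
      linear_combination ((b : ZMod (ℓ ^ 2)) * t ^ 2) * hℓ2
    rw [e1, Finset.sum_comm]
    simp_rw [e2, ← Finset.mul_sum, AddChar.sum_mulShift _ (ZMod.isPrimitive_stdAddChar (ℓ ^ 2)),
      (h2.mul hb).mul_right_eq_zero, ZMod.card]
    rw [Finset.card_filter, Nat.cast_sum, Finset.mul_sum]
    refine Finset.sum_congr rfl fun x _ ↦ ?_
    split_ifs with hx
    · have hx2 : (b : ZMod (ℓ ^ 2)) * x ^ 2 = 0 := by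
        obtain ⟨y, rfl⟩ := ZMod.natCast_zmod_surjective x
        have hy : ℓ ∣ y := by
          have h : ((ℓ * y : ℕ) : ZMod (ℓ ^ 2)) = 0 := by exact_mod_cast hx
          rw [ZMod.natCast_eq_zero_iff, pow_two] at h
          exact Nat.dvd_of_mul_dvd_mul_left (Fact.out : ℓ.Prime).pos h
        obtain ⟨z, rfl⟩ := hy
        push_cast
        linear_combination ((b : ZMod (ℓ ^ 2)) * (z : ZMod (ℓ ^ 2)) ^ 2) * hℓ2
      simp [hx2]
    · simp
  have h := mul_left_cancel₀ hN key
  have h4 := quadGauss_pow_four hodd hb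
  rw [h] at h4 ⊢
  norm_cast at h4 ⊢
  rw [← pow_mul] at h4
  exact Nat.pow_left_injective (n := 4) (by norm_num) h4

end LegendreGauss

/-! ### Fourier expansions and sums of translates -/

section Expansion

/-- `f(z) = ∑ a(n) exp(2πi n z / 24)` on the upper half plane. -/
def HasExpansion (f : ℂ → ℂ) (a : ℕ → ℂ) : Prop :=
  ∀ z : ℂ, 0 < z.im → HasSum (fun n : ℕ ↦ a n * Complex.exp (2 * π * Complex.I * n * z / 24)) (f z)

/-- The value of `f` at `(z + 24 b) / D`, for a residue class `b` modulo `D`. -/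
def translate (f : ℂ → ℂ) (D : ℕ) (z : ℂ) (b : ZMod D) : ℂ := f ((z + 24 * b.val) / D)

lemma im_add_div_pos {D : ℕ} (hD : D ≠ 0) {z : ℂ} (hz : 0 < z.im) (x : ℝ) :
    0 < ((z + x) / D).im := by
  rw [Complex.div_natCast_im, Complex.add_im, Complex.ofReal_im, add_zero]
  positivity

variable {f : ℂ → ℂ} {a : ℕ → ℂ}

lemma HasExpansion.add_intCast (h : HasExpansion f a) (j : ℤ) {z : ℂ} (hz : 0 < z.im) :
    f (z + 24 * j) = f z := by
  have h1 := h (z + 24 * j) (by simpa using hz)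
  refine (h1.congr_fun fun n ↦ ?_).unique (h z hz)
  rw [show 2 * π * Complex.I * n * (z + 24 * j) / 24 =
    2 * π * Complex.I * n * z / 24 + (n * j : ℤ) * (2 * π * Complex.I) by push_cast; ring,
    Complex.exp_periodic.int_mul (n * j)]

lemma HasExpansion.translate_intCast (h : HasExpansion f a) {D : ℕ} [NeZero D] (b : ℤ) {z : ℂ}
    (hz : 0 < z.im) : translate f D z (b : ZMod D) = f ((z + 24 * b) / D) := by
  have hD : (D : ℂ) ≠ 0 := NeZero.ne _
  obtain ⟨j, hj⟩ : (D : ℤ) ∣ b - ((b : ZMod D).val : ℤ) := by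
    rw [← ZMod.intCast_zmod_eq_zero_iff_dvd]; simp
  have hj' : (b : ℂ) = ((b : ZMod D).val : ℂ) + D * j := by
    have : b = ((b : ZMod D).val : ℤ) + D * j := by linear_combination hj
    exact_mod_cast this
  have := h.add_intCast j (im_add_div_pos (NeZero.ne D) hz (24 * ((b : ZMod D).val : ℝ)))
  rw [translate]
  push_cast at this
  rw [← this, hj']
  congr 1
  field_simp
  ring

lemma HasExpansion.hasSum_translate (h : HasExpansion f a) {D : ℕ} [NeZero D] (ψ : ZMod D → ℂ)
    {z : ℂ} (hz : 0 < z.im) :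
    HasSum (fun n : ℕ ↦ a n * (∑ b : ZMod D, ψ b * ZMod.stdAddChar ((n : ZMod D) * b)) *
      Complex.exp (2 * π * Complex.I * n * (z / D) / 24)) (∑ b : ZMod D, ψ b * translate f D z b) := by
  have hD : (D : ℂ) ≠ 0 := NeZero.ne _
  have h1 := hasSum_sum (s := Finset.univ) fun (b : ZMod D) _ ↦
    (h ((z + 24 * b.val) / D) (by
      have := im_add_div_pos (NeZero.ne D) hz (24 * (b.val : ℝ))
      push_cast at this
      exact this)).mul_left (ψ b)
  refine h1.congr_fun fun n ↦ ?_
  rw [Finset.mul_sum, Finset.sum_mul]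
  refine Finset.sum_congr rfl fun b _ ↦ ?_
  have : (ZMod.stdAddChar ((n : ZMod D) * b) : ℂ) =
      Complex.exp (2 * π * Complex.I * (n * b.val : ℤ) / D) := by
    rw [← ZMod.stdAddChar_coe]; simp
  rw [this, show 2 * π * Complex.I * n * ((z + 24 * b.val) / D) / 24 =
    2 * π * Complex.I * (n * b.val : ℤ) / D + 2 * π * Complex.I * n * (z / D) / 24 by
      push_cast; field_simp; ring, Complex.exp_add]
  ring

/-- The operator `∑ a(n) q^n ↦ ∑ a(D n) q^n`. -/
lemma HasExpansion.hasSum_dilate_inv (h : HasExpansion f a) {D : ℕ} [NeZero D] {z : ℂ}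
    (hz : 0 < z.im) :
    HasSum (fun n : ℕ ↦ a (D * n) * Complex.exp (2 * π * Complex.I * n * z / 24))
      ((D : ℂ)⁻¹ * ∑ b : ZMod D, translate f D z b) := by
  have hD : (D : ℂ) ≠ 0 := NeZero.ne _
  have h1 := (h.hasSum_translate (D := D) (fun _ ↦ 1) hz).mul_left (D : ℂ)⁻¹
  simp only [one_mul] at h1
  have hsum : ∀ n : ℕ, ∑ b : ZMod D, (ZMod.stdAddChar ((n : ZMod D) * b) : ℂ) =
      if D ∣ n then (D : ℂ) else 0 := by
    intro n
    simp_rw [mul_comm (n : ZMod D)]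
    rw [AddChar.sum_mulShift _ (ZMod.isPrimitive_stdAddChar D), ZMod.card]
    simp only [ZMod.natCast_eq_zero_iff]
    split_ifs <;> simp
  simp_rw [hsum] at h1
  have hinj : Function.Injective fun n : ℕ ↦ D * n :=
    fun x y hxy ↦ Nat.eq_of_mul_eq_mul_left (NeZero.pos D) hxy
  rw [← hinj.hasSum_iff] at h1
  · refine h1.congr_fun fun n ↦ ?_
    simp only [Function.comp_apply, dvd_mul_right, if_true]
    rw [show 2 * π * Complex.I * (D * n : ℕ) * (z / D) / 24 = 2 * π * Complex.I * n * z / 24 by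
      push_cast; field_simp]
    field_simp
  · intro n hn
    rw [if_neg fun hd ↦ hn ⟨n / D, Nat.mul_div_cancel' hd⟩]
    simp

/-- The operator `∑ a(n) q^n ↦ ∑ a(n) q^(D n)`. -/
lemma HasExpansion.hasSum_dilate (h : HasExpansion f a) {D : ℕ} [NeZero D] {z : ℂ}
    (hz : 0 < z.im) :
    HasSum (fun n : ℕ ↦ (if D ∣ n then a (n / D) else 0) *
      Complex.exp (2 * π * Complex.I * n * z / 24)) (f (D * z)) := by
  have h1 := h (D * z) (by simpa using mul_pos (Nat.cast_pos.mpr (NeZero.pos D)) hz)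
  have hinj : Function.Injective fun n : ℕ ↦ D * n :=
    fun x y hxy ↦ Nat.eq_of_mul_eq_mul_left (NeZero.pos D) hxy
  rw [← hinj.hasSum_iff]
  · refine h1.congr_fun fun n ↦ ?_
    simp only [Function.comp_apply, dvd_mul_right, if_true,
      Nat.mul_div_cancel_left n (NeZero.pos D)]
    congr 2
    push_cast
    ring
  · intro n hn
    rw [if_neg fun hd ↦ hn ⟨n / D, Nat.mul_div_cancel' hd⟩, zero_mul]

lemma HasExpansion.hasSum_legendre (h : HasExpansion f a) {ℓ : ℕ} [Fact ℓ.Prime] (hℓ : ℓ ≠ 2)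
    {z : ℂ} (hz : 0 < z.im) :
    HasSum (fun n : ℕ ↦ a n * (legendreChar ℓ n * legendreGauss ℓ) *
      Complex.exp (2 * π * Complex.I * n * z / 24))
      (∑ b : ZMod ℓ, legendreChar ℓ b * translate f ℓ (ℓ * z) b) := by
  have hD : (ℓ : ℂ) ≠ 0 := NeZero.ne _
  have h1 := h.hasSum_translate (D := ℓ) (legendreChar ℓ) (z := ℓ * z)
    (by simpa using mul_pos (Nat.cast_pos.mpr (NeZero.pos ℓ)) hz)
  simp_rw [sum_legendreChar_mul hℓ, mul_div_cancel_left₀ z hD] at h1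
  exact h1

end Expansion

/-! ### Inversion of η^r F at rational points -/

section Inversion

variable {r m : ℕ} (F : ModularForm 𝒮ℒ (m : ℤ))

/-- The function `η(z)^r F(z)` on the upper half plane. -/
def etaForm (r : ℕ) {m : ℤ} (F : ModularForm 𝒮ℒ m) (z : ℂ) : ℂ := eta z ^ r * F (ofComplex z)

/-- The automorphy factor of `η^r F` under `σ ↦ -1 / σ`. -/
def autFactor (r m : ℕ) (σ : ℂ) : ℂ := ((-Complex.I * σ) ^ (1 / 2 : ℂ)) ^ r * σ ^ m

/-- The fourth root of unity `χ₁₂(D) D^(-1/2) ∑ exp(2πi b x² / D)`. -/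
def gaussPhase (D : ℕ) [NeZero D] (b : ℤ) : ℂ :=
  chiTwelve (D : ZMod 12) * (quadGauss D b / (√D : ℝ))

lemma modularForm_inversion {D : ℕ} [NeZero D] {b b' : ℤ} (hb : (D : ℤ) ∣ 576 * b * b' + 1) {σ : ℂ}
    (hσ : 0 < σ.im) :
    F (ofComplex ((24 * b - 1 / σ) / D)) = σ ^ m * F (ofComplex ((σ + 24 * b') / D)) := by
  obtain ⟨y, hy⟩ := hb
  have hD : (D : ℂ) ≠ 0 := NeZero.ne _
  have hσ0 : σ ≠ 0 := by rintro rfl; simp at hσ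
  have him : 0 < ((σ + 24 * b') / D).im := by
    have := im_add_div_pos (NeZero.ne D) hσ (24 * (b' : ℝ))
    push_cast at this
    exact this
  obtain ⟨γ, h00, h01, h10, h11⟩ : ∃ γ : SL(2, ℤ), γ 0 0 = 24 * b ∧ γ 0 1 = -y ∧
      γ 1 0 = D ∧ γ 1 1 = -(24 * b') :=
    ⟨⟨!![24 * b, -y; D, -(24 * b')], by rw [Matrix.det_fin_two_of]; linear_combination -hy⟩,
      rfl, rfl, rfl, rfl⟩
  have hy' : (576 : ℂ) * b * b' + 1 = D * y := by exact_mod_cast hy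
  set w : ℍ := ⟨(σ + 24 * b') / D, him⟩ with hw
  have hwc : (w : ℂ) = (σ + 24 * b') / D := rfl
  have hden : UpperHalfPlane.denom γ w = σ := by
    simp only [UpperHalfPlane.denom, hwc]
    simp [h10, h11]
    field_simp
    ring
  have hsm : ((γ • w : ℍ) : ℂ) = (24 * b - 1 / σ) / D := by
    rw [UpperHalfPlane.coe_specialLinearGroup_apply, h00, h01, h10, h11, hwc]
    simp only [algebraMap_int_eq, eq_intCast, Complex.ofReal_intCast]
    push_cast
    rw [show (D : ℂ) * ((σ + 24 * b') / D) + -(24 * b') = σ by field_simp; ring]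
    field_simp
    linear_combination hy'
  have hF := SlashInvariantForm.slash_action_eqn'' (Γ := 𝒮ℒ) F
    (γ := Matrix.SpecialLinearGroup.mapGL ℝ γ) ⟨γ, rfl⟩ w
  rw [← hsm, ← hwc, ofComplex_apply, ofComplex_apply]
  refine hF.trans ?_
  rw [zpow_natCast, ← hden]
  rfl

lemma etaForm_inversion (r : ℕ) {D : ℕ} [NeZero D] (hD : Nat.Coprime 12 D) {b b' : ℤ}
    (hb : (D : ℤ) ∣ 576 * b * b' + 1) {σ : ℂ} (hσ : 0 < σ.im) :
    etaForm r F ((24 * b - 1 / σ) / D) =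
      gaussPhase D b ^ r * autFactor r m σ * etaForm r F ((σ + 24 * b') / D) := by
  rw [etaForm, modularForm_inversion F hb hσ, eta_inversion hD hb hσ, gaussPhase, autFactor, etaForm]
  ring

lemma gaussPhase_one (b : ℤ) : gaussPhase 1 b = 1 := by
  simp [gaussPhase, quadGauss_one]

lemma autFactor_mul {c : ℝ} (hc : 0 < c) (σ : ℂ) :
    autFactor r m (c * σ) = ((√c : ℝ) : ℂ) ^ (r + 2 * m) * autFactor r m σ := by
  rw [autFactor, autFactor, show -Complex.I * (c * σ) = (c : ℂ) * (-Complex.I * σ) by ring,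
    ofReal_mul_cpow_half hc, mul_pow, mul_pow, pow_add, pow_mul, ← Complex.ofReal_pow _ 2,
    Real.sq_sqrt hc.le]
  ring

lemma isUnit_576 {D : ℕ} (hD : Nat.Coprime 12 D) : IsUnit (576 : ZMod D) := by
  have : Nat.Coprime 576 D := by
    rw [show 576 = 12 ^ 2 * 2 ^ 2 by norm_num]
    exact (hD.pow_left 2).mul_left
      ((Nat.Coprime.coprime_dvd_left (by norm_num) hD : Nat.Coprime 2 D).pow_left 2)
  simpa using (ZMod.isUnit_iff_coprime 576 D).mpr this

/-- The involution `b ↦ -1 / (576 b)` of the units modulo `D`. -/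
def unitInv {D : ℕ} (hD : Nat.Coprime 12 D) : (ZMod D)ˣ ≃ (ZMod D)ˣ :=
  (Equiv.inv _).trans (Equiv.mulLeft (-(isUnit_576 hD).unit⁻¹))

lemma mul_unitInv {D : ℕ} (hD : Nat.Coprime 12 D) (u : (ZMod D)ˣ) :
    (576 : ZMod D) * u * (unitInv hD u : (ZMod D)ˣ) = -1 := by
  have h : (576 : ZMod D) = ((isUnit_576 hD).unit : (ZMod D)ˣ) := rfl
  rw [h, ← Units.val_mul, ← Units.val_mul, unitInv]
  simp only [Equiv.trans_apply, Equiv.inv_apply, Equiv.coe_mulLeft]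
  rw [show (isUnit_576 hD).unit * u * (-(isUnit_576 hD).unit⁻¹ * u⁻¹) = -1 by
    rw [neg_mul, mul_neg, mul_mul_mul_comm, mul_inv_cancel, mul_inv_cancel, one_mul]]
  simp

section Units

lemma sum_units_add_sum_not_isUnit {M : Type*} [Monoid M] [Fintype M] [Fintype Mˣ]
    [DecidablePred (IsUnit : M → Prop)] (g : M → ℂ) :
    ∑ u : Mˣ, g u + ∑ x with ¬ IsUnit x, g x = ∑ x, g x := by
  rw [← Finset.sum_filter_add_sum_filter_not Finset.univ (fun x : M ↦ IsUnit x)]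
  congr 1
  refine Finset.sum_bij (fun u _ ↦ (u : M)) (fun u _ ↦ by simp) (fun u _ v _ h ↦ Units.ext h)
    (fun x hx ↦ ?_) fun _ _ ↦ rfl
  obtain ⟨u, rfl⟩ := (Finset.mem_filter.mp hx).2
  exact ⟨u, Finset.mem_univ _, rfl⟩

lemma sum_eq_zero_add_sum_units {ℓ : ℕ} [Fact ℓ.Prime] (g : ZMod ℓ → ℂ) :
    ∑ x, g x = g 0 + ∑ u : (ZMod ℓ)ˣ, g u := by
  classical
  rw [← sum_units_add_sum_not_isUnit, add_comm]
  congr 1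
  simp [isUnit_iff_ne_zero, Finset.filter_eq']

lemma sum_zmod_sq {ℓ : ℕ} [hℓ : Fact ℓ.Prime] [NeZero (ℓ ^ 2)] (g : ZMod (ℓ ^ 2) → ℂ) :
    ∑ x, g x = ∑ u : (ZMod (ℓ ^ 2))ˣ, g u + ∑ c : ZMod ℓ, g ((ℓ * c.val : ℕ) : ZMod (ℓ ^ 2)) := by
  classical
  rw [← sum_units_add_sum_not_isUnit]
  congr 1
  have hlt : ∀ c : ZMod ℓ, ℓ * c.val < ℓ ^ 2 := fun c ↦ by
    rw [pow_two]; exact Nat.mul_lt_mul_of_pos_left c.val_lt hℓ.out.pos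
  have hu : ∀ n : ℕ, IsUnit (n : ZMod (ℓ ^ 2)) ↔ ¬ ℓ ∣ n := fun n ↦ by
    rw [ZMod.isUnit_iff_coprime, Nat.coprime_pow_right_iff (by norm_num), Nat.coprime_comm,
      hℓ.out.coprime_iff_not_dvd]
  symm
  refine Finset.sum_bij (fun c _ ↦ ((ℓ * c.val : ℕ) : ZMod (ℓ ^ 2))) (fun c _ ↦ ?_)
    (fun c _ c' _ h ↦ ?_) (fun x hx ↦ ?_) fun _ _ ↦ rfl
  · rw [Finset.mem_filter, hu]
    exact ⟨Finset.mem_univ _, not_not.mpr (Dvd.intro _ rfl)⟩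
  · have := congrArg ZMod.val h
    rw [ZMod.val_natCast_of_lt (hlt c), ZMod.val_natCast_of_lt (hlt c')] at this
    exact ZMod.val_injective ℓ (Nat.eq_of_mul_eq_mul_left hℓ.out.pos this)
  · rw [Finset.mem_filter, ← ZMod.natCast_zmod_val x, hu, not_not] at hx
    obtain ⟨y, hy⟩ := hx.2
    have hy' : y < ℓ := by
      have := x.val_lt
      rw [hy, pow_two] at this
      exact Nat.lt_of_mul_lt_mul_left this
    refine ⟨(y : ZMod ℓ), Finset.mem_univ _, ?_⟩
    rw [ZMod.val_natCast_of_lt hy', ← hy, ZMod.natCast_zmod_val]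

end Units

/-- The functions `f` of period `24` that transform like `η^r F`. -/
structure EtaInversion (r m : ℕ) (f : ℂ → ℂ) (a : ℕ → ℂ) : Prop where
  expansion : HasExpansion f a
  inversion : ∀ (D : ℕ) [NeZero D], Nat.Coprime 12 D → ∀ b b' : ℤ, (D : ℤ) ∣ 576 * b * b' + 1 →
    ∀ σ : ℂ, 0 < σ.im → f ((24 * b - 1 / σ) / D) =
      gaussPhase D b ^ r * autFactor r m σ * f ((σ + 24 * b') / D)

variable {f : ℂ → ℂ} {a : ℕ → ℂ}

/-- Inversion permutes the translates by units through `b ↦ -1 / (576 b)`, up to a phase that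
depends on `b`. -/
lemma EtaInversion.translate_inversion (h : EtaInversion r m f a) {D : ℕ} [NeZero D]
    (hD : Nat.Coprime 12 D) (u : (ZMod D)ˣ) {σ : ℂ} (hσ : 0 < σ.im) :
    translate f D (-1 / σ) u =
      gaussPhase D (u : ZMod D).val ^ r * autFactor r m σ * translate f D σ (unitInv hD u) := by
  have hd : (D : ℤ) ∣ 576 * ((u : ZMod D).val : ℤ) * ((unitInv hD u : ZMod D).val : ℤ) + 1 := by
    rw [← ZMod.intCast_zmod_eq_zero_iff_dvd]
    push_cast
    rw [ZMod.natCast_zmod_val, ZMod.natCast_zmod_val, mul_unitInv]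
    ring
  have := h.inversion D hD _ _ hd σ hσ
  rw [translate, translate]
  push_cast at this
  rw [← this]
  congr 2
  ring

lemma EtaInversion.neg_inv (h : EtaInversion r m f a) {σ : ℂ} (hσ : 0 < σ.im) :
    f (-1 / σ) = autFactor r m σ * f σ := by
  have := h.inversion 1 (by norm_num) 0 0 (by norm_num) σ hσ
  simpa [gaussPhase_one, neg_div] using this

end Inversion

/-! ### The Hecke operator commutes with z ↦ -1/z -/

section HeckeInversion

variable {r m : ℕ} {f : ℂ → ℂ} {a : ℕ → ℂ} {ℓ : ℕ} [Fact ℓ.Prime]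

/-- The sum of the translates of `f` over the units modulo `D`, twisted by `ψ`. -/
def unitSum (f : ℂ → ℂ) (D : ℕ) [NeZero D] (ψ : ZMod D → ℂ) (z : ℂ) : ℂ :=
  ∑ u : (ZMod D)ˣ, ψ u * translate f D z u

lemma coprime_twelve_prime (hℓ : 3 < ℓ) : Nat.Coprime 12 ℓ := by
  have h := (Fact.out : ℓ.Prime)
  rw [Nat.coprime_comm, h.coprime_iff_not_dvd]
  intro hd
  rw [show 12 = 2 * 2 * 3 by norm_num, h.dvd_mul, h.dvd_mul] at hd
  rcases hd with (hd | hd) | hd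
  · have := Nat.le_of_dvd (by norm_num) hd; omega
  · have := Nat.le_of_dvd (by norm_num) hd; omega
  · have := Nat.le_of_dvd (by norm_num) hd; omega

lemma chiTwelve_sq_of_coprime {n : ℕ} (hn : Nat.Coprime 12 n) :
    chiTwelve (n : ZMod 12) ^ 2 = 1 := by
  have h : ∀ x, IsUnit x → chiTwelveInt x ^ 2 = 1 := by decide
  rw [chiTwelve_apply]
  exact_mod_cast h n ((ZMod.isUnit_iff_coprime n 12).mpr hn.symm)

/-- Modulo `ℓ²` the phase does not depend on the unit, so the untwisted sum is carried to itself. -/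
lemma gaussPhase_sq (hℓ : 3 < ℓ) [NeZero (ℓ ^ 2)] (u : (ZMod (ℓ ^ 2))ˣ) :
    gaussPhase (ℓ ^ 2) (u : ZMod (ℓ ^ 2)).val = 1 := by
  have hℓ0 : (ℓ : ℂ) ≠ 0 := NeZero.ne _
  rw [gaussPhase, quadGauss_prime_sq (by omega) (by simp), Nat.cast_pow, map_pow,
    chiTwelve_sq_of_coprime (coprime_twelve_prime hℓ), Nat.cast_pow,
    Real.sqrt_sq (Nat.cast_nonneg _), Complex.ofReal_natCast, div_self hℓ0, one_mul]

variable (ℓ) in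
/-- The fourth root of unity `χ₁₂(ℓ) ℓ^(-1/2) ∑ (b / ℓ) exp(2πi b / ℓ)`. -/
def primePhase : ℂ := chiTwelve (ℓ : ZMod 12) * (legendreGauss ℓ / (√ℓ : ℝ))

/-- Modulo `ℓ` the phase contains the Legendre symbol, which survives the odd power `r`; this
exchanges untwisted and twisted sums. -/
lemma gaussPhase_prime (hℓ : 3 < ℓ) (u : (ZMod ℓ)ˣ) :
    gaussPhase ℓ (u : ZMod ℓ).val = legendreChar ℓ u * primePhase ℓ := by
  have h : ((((u : ZMod ℓ).val : ℕ) : ℤ) : ZMod ℓ) = u := by simp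
  rw [gaussPhase, quadGauss_prime (by omega) (by rw [h]; exact u.ne_zero), h, primePhase]
  ring

lemma primePhase_sq (hℓ : 3 < ℓ) : primePhase ℓ ^ 2 = legendreChar ℓ (-1) := by
  have hℓ0 : (ℓ : ℂ) ≠ 0 := NeZero.ne _
  rw [primePhase, mul_pow, div_pow, chiTwelve_sq_of_coprime (coprime_twelve_prime hℓ),
    legendreGauss_sq (by omega), ← Complex.ofReal_pow, Real.sq_sqrt (Nat.cast_nonneg _),
    Complex.ofReal_natCast, one_mul, mul_div_cancel_right₀ _ hℓ0]

/-- `576 = 24²` is a square, so only the symbol of `-1` remains. -/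
lemma legendreChar_unitInv (hℓ : 3 < ℓ) (u : (ZMod ℓ)ˣ) :
    legendreChar ℓ (unitInv (coprime_twelve_prime hℓ) u : (ZMod ℓ)ˣ) =
      legendreChar ℓ (-1) * legendreChar ℓ u := by
  have h := mul_unitInv (coprime_twelve_prime hℓ) u
  have h24 : (24 : ZMod ℓ) ≠ 0 := by
    have := (isUnit_576 (coprime_twelve_prime hℓ)).ne_zero
    intro h
    exact this (by linear_combination (24 : ZMod ℓ) * h)
  rw [← h, show (576 : ZMod ℓ) = 24 ^ 2 by norm_num, map_mul, map_mul, map_pow, legendreChar_sq h24]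
  linear_combination (-legendreChar ℓ (unitInv (coprime_twelve_prime hℓ) u : (ZMod ℓ)ˣ)) *
    legendreChar_sq u.ne_zero

lemma EtaInversion.unitSum_sq (h : EtaInversion r m f a) (hℓ : 3 < ℓ) [NeZero (ℓ ^ 2)] {σ : ℂ}
    (hσ : 0 < σ.im) :
    unitSum f (ℓ ^ 2) 1 (-1 / σ) = autFactor r m σ * unitSum f (ℓ ^ 2) 1 σ := by
  have hD : Nat.Coprime 12 (ℓ ^ 2) := (coprime_twelve_prime hℓ).pow_right 2
  simp only [unitSum, Pi.one_apply, one_mul]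
  rw [Finset.mul_sum, ← Equiv.sum_comp (unitInv hD) 
    (fun u : (ZMod (ℓ ^ 2))ˣ ↦ autFactor r m σ * translate f (ℓ ^ 2) σ (u : ZMod (ℓ ^ 2)))]
  refine Finset.sum_congr rfl fun u _ ↦ ?_
  rw [h.translate_inversion hD u hσ, gaussPhase_sq hℓ, one_pow, one_mul]

lemma legendreChar_pow_odd (hr : Odd r) (x : (ZMod ℓ)ˣ) :
    legendreChar ℓ x ^ r = legendreChar ℓ x := by
  obtain ⟨t, rfl⟩ := hr
  rw [pow_succ, pow_mul, legendreChar_sq x.ne_zero, one_pow, one_mul]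

lemma EtaInversion.unitSum_one (h : EtaInversion r m f a) (hr : Odd r) (hℓ : 3 < ℓ) {σ : ℂ}
    (hσ : 0 < σ.im) :
    unitSum f ℓ 1 (-1 / σ) =
      primePhase ℓ ^ r * legendreChar ℓ (-1) * autFactor r m σ * unitSum f ℓ (legendreChar ℓ) σ := by
  have hD := coprime_twelve_prime hℓ
  have h1 : legendreChar ℓ (-1) ^ 2 = 1 := legendreChar_sq (neg_ne_zero.mpr one_ne_zero)
  simp only [unitSum, Pi.one_apply, one_mul]
  rw [Finset.mul_sum, ← Equiv.sum_comp (unitInv hD)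
    (fun u : (ZMod ℓ)ˣ ↦ primePhase ℓ ^ r * legendreChar ℓ (-1) * autFactor r m σ *
      (legendreChar ℓ u * translate f ℓ σ u))]
  refine Finset.sum_congr rfl fun u _ ↦ ?_
  rw [h.translate_inversion hD u hσ, gaussPhase_prime hℓ, mul_pow, legendreChar_pow_odd hr,
    legendreChar_unitInv hℓ]
  linear_combination (-(legendreChar ℓ u * primePhase ℓ ^ r * autFactor r m σ *
    translate f ℓ σ (unitInv hD u))) * h1

lemma EtaInversion.unitSum_legendre (h : EtaInversion r m f a) (hr : Odd r) (hℓ : 3 < ℓ) {σ : ℂ}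
    (hσ : 0 < σ.im) :
    unitSum f ℓ (legendreChar ℓ) (-1 / σ) =
      primePhase ℓ ^ r * autFactor r m σ * unitSum f ℓ 1 σ := by
  have hD := coprime_twelve_prime hℓ
  simp only [unitSum, Pi.one_apply, one_mul]
  rw [Finset.mul_sum, ← Equiv.sum_comp (unitInv hD)
    (fun u : (ZMod ℓ)ˣ ↦ primePhase ℓ ^ r * autFactor r m σ * translate f ℓ σ u)]
  refine Finset.sum_congr rfl fun u _ ↦ ?_
  rw [h.translate_inversion hD u hσ, gaussPhase_prime hℓ, mul_pow, legendreChar_pow_odd hr]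
  linear_combination (primePhase ℓ ^ r * autFactor r m σ * translate f ℓ σ (unitInv hD u)) *
    legendreChar_sq u.ne_zero

/-- The Hecke operator on functions `f(z) = ∑ a(n) exp(2πi n z / 24)`, as a sum of translates, with
coefficients `μ` and `ν` of the second and third term. -/
def heckeSum (f : ℂ → ℂ) (ℓ : ℕ) [Fact ℓ.Prime] (μ ν : ℂ) (z : ℂ) : ℂ :=
  ((ℓ : ℂ) ^ 2)⁻¹ * (f (z / ℓ ^ 2) + unitSum f ℓ 1 (z / ℓ) + unitSum f (ℓ ^ 2) 1 z) +
    μ * unitSum f ℓ (legendreChar ℓ) (ℓ * z) + ν * f (ℓ ^ 2 * z)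

/-- The first and last terms are exchanged, as are the two sums modulo `ℓ`; the sum modulo `ℓ²` is
fixed. The given `μ` and `ν` are what these exchanges require of the coefficients. -/
theorem EtaInversion.heckeSum_neg_inv (h : EtaInversion r m f a) (hr : Odd r) (hℓ : 3 < ℓ)
    {μ ν : ℂ}
    (hμ : μ = ((ℓ : ℂ) ^ 2)⁻¹ * primePhase ℓ ^ r * legendreChar ℓ (-1) * (√ℓ : ℝ) ^ (r + 2 * m))
    (hν : ν = ((ℓ : ℂ) ^ 2)⁻¹ * (ℓ : ℂ) ^ (r + 2 * m)) {τ : ℂ} (hτ : 0 < τ.im) :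
    heckeSum f ℓ μ ν (-1 / τ) = autFactor r m τ * heckeSum f ℓ μ ν τ := by
  have hpos : (0 : ℝ) < ℓ := Nat.cast_pos.mpr (NeZero.pos ℓ)
  have hℓ0 : (ℓ : ℂ) ≠ 0 := NeZero.ne _
  have hτ0 : τ ≠ 0 := by rintro rfl; simp at hτ
  set s : ℂ := ((√ℓ : ℝ) : ℂ) with hs
  have hs2 : s ^ 2 = ℓ := by
    rw [hs, ← Complex.ofReal_pow, Real.sq_sqrt hpos.le, Complex.ofReal_natCast]
  have hs0 : s ≠ 0 := by rintro h; rw [h] at hs2; simp at hs2; exact hℓ0 hs2.symm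
  have hmul : ∀ σ : ℂ, autFactor r m (ℓ * σ) = s ^ (r + 2 * m) * autFactor r m σ := fun σ ↦ by
    have := autFactor_mul (r := r) (m := m) hpos σ
    rwa [Complex.ofReal_natCast] at this
  have hmul2 : ∀ σ : ℂ, autFactor r m (ℓ ^ 2 * σ) = (ℓ : ℂ) ^ (r + 2 * m) * autFactor r m σ :=
    fun σ ↦ by rw [pow_two, mul_assoc, hmul, hmul, ← hs2]; ring
  have him : 0 < ((ℓ : ℂ) * τ).im := by simpa using mul_pos hpos hτ
  have him2 : 0 < ((ℓ : ℂ) ^ 2 * τ).im := by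
    rw [pow_two, mul_assoc]; simpa using mul_pos hpos (by simpa using him)
  have him' : 0 < (τ / ℓ).im := by rw [Complex.div_natCast_im]; positivity
  have him2' : 0 < (τ / ℓ ^ 2).im := by
    rw [pow_two, ← div_div, Complex.div_natCast_im]; positivity
  have e1 : f (-1 / τ / ℓ ^ 2) = (ℓ : ℂ) ^ (r + 2 * m) * autFactor r m τ * f (ℓ ^ 2 * τ) := by
    rw [show -1 / τ / (ℓ : ℂ) ^ 2 = -1 / (ℓ ^ 2 * τ) by field_simp, h.neg_inv him2, hmul2]
  have e2 : unitSum f ℓ 1 (-1 / τ / ℓ) = primePhase ℓ ^ r * legendreChar ℓ (-1) *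
      (s ^ (r + 2 * m) * autFactor r m τ) * unitSum f ℓ (legendreChar ℓ) (ℓ * τ) := by
    rw [show -1 / τ / (ℓ : ℂ) = -1 / (ℓ * τ) by field_simp, h.unitSum_one hr hℓ him, hmul]
  have e3 := h.unitSum_sq hℓ hτ
  have e4 : s ^ (r + 2 * m) * unitSum f ℓ (legendreChar ℓ) (ℓ * (-1 / τ)) =
      primePhase ℓ ^ r * autFactor r m τ * unitSum f ℓ 1 (τ / ℓ) := by
    have hA := hmul (τ / ℓ)
    rw [mul_div_cancel₀ _ hℓ0] at hA
    rw [show ℓ * (-1 / τ) = -1 / (τ / ℓ) by field_simp, h.unitSum_legendre hr hℓ him', hA]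
    ring
  have e5 : (ℓ : ℂ) ^ (r + 2 * m) * f (ℓ ^ 2 * (-1 / τ)) = autFactor r m τ * f (τ / ℓ ^ 2) := by
    have hA := hmul2 (τ / ℓ ^ 2)
    rw [mul_div_cancel₀ _ (pow_ne_zero 2 hℓ0)] at hA
    rw [show (ℓ : ℂ) ^ 2 * (-1 / τ) = -1 / (τ / ℓ ^ 2) by field_simp, h.neg_inv him2', hA]
    ring
  -- Consistency of the exchange modulo `ℓ`: applying it in both directions must give the trivial
  -- phase.
  have hone : primePhase ℓ ^ r * primePhase ℓ ^ r * legendreChar ℓ (-1) = 1 := by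
    have h1 : legendreChar ℓ (-1) ^ 2 = 1 := legendreChar_sq (neg_ne_zero.mpr one_ne_zero)
    obtain ⟨t, rfl⟩ := hr
    rw [← pow_add, ← two_mul, pow_mul, primePhase_sq hℓ, ← pow_succ,
      show 2 * t + 1 + 1 = 2 * (t + 1) by ring, pow_mul, h1, one_pow]
  rw [heckeSum, heckeSum, e1, e2, e3, hμ, hν]
  linear_combination (((ℓ : ℂ) ^ 2)⁻¹ * primePhase ℓ ^ r * legendreChar ℓ (-1)) * e4 +
    ((ℓ : ℂ) ^ 2)⁻¹ * e5 + ((ℓ : ℂ) ^ 2)⁻¹ * autFactor r m τ * unitSum f ℓ 1 (τ / ℓ) * hone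

end HeckeInversion

/-! ### Fourier coefficients of η^r F -/

section HeckeExpansion

variable {r m : ℕ} (F : ModularForm 𝒮ℒ (m : ℤ))

lemma eta_add_one (z : ℂ) : eta (z + 1) = Complex.exp (2 * π * Complex.I / 24) * eta z := by
  have h1 : Function.Periodic.qParam 1 (z + 1) = Function.Periodic.qParam 1 z := by
    rw [Function.Periodic.qParam, Function.Periodic.qParam, Complex.exp_eq_exp_iff_exists_int]
    exact ⟨1, by push_cast; ring⟩
  have h2 : Function.Periodic.qParam 24 (z + 1) =
      Complex.exp (2 * π * Complex.I / 24) * Function.Periodic.qParam 24 z := by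
    rw [Function.Periodic.qParam, Function.Periodic.qParam, ← Complex.exp_add]
    congr 1
    push_cast
    ring
  simp only [eta, h1, h2, mul_assoc, eta_q]

lemma etaForm_add_one (r : ℕ) {m : ℤ} (F : ModularForm 𝒮ℒ m) (z : ℂ) :
    etaForm r F (z + 1) = Complex.exp (2 * π * Complex.I * r / 24) * etaForm r F z := by
  have h := SlashInvariantFormClass.periodic_comp_ofComplex F one_mem_strictPeriods_SL z
  simp only [Function.comp_apply, Complex.ofReal_one] at h
  rw [etaForm, etaForm, h, eta_add_one, mul_pow, ← Complex.exp_nat_mul, mul_assoc]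
  congr 2
  ring

lemma etaForm_add_natCast (r : ℕ) {m : ℤ} (F : ModularForm 𝒮ℒ m) (z : ℂ) (j : ℕ) :
    etaForm r F (z + j) = Complex.exp (2 * π * Complex.I * r * j / 24) * etaForm r F z := by
  induction j with
  | zero => simp
  | succ j ih =>
    rw [Nat.cast_succ, ← add_assoc, etaForm_add_one, ih, ← mul_assoc, ← Complex.exp_add]
    congr 2
    ring

lemma etaForm_coe (r : ℕ) {m : ℤ} (F : ModularForm 𝒮ℒ m) (τ : ℍ) :
    etaForm r F (24 * τ) = etaTwist r F τ := by
  rw [etaForm, etaTwist, ← ofComplex_apply (dilate 24 τ), coe_dilate]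
  rfl

lemma isBoundedAtImInfty_etaTwist (hr : Odd r) : IsBoundedAtImInfty (etaTwist r F) := by
  have hp : IsShimuraPair 1 (fun _ ↦ 1) :=
    ⟨mdifferentiable_const, 1, by simp, fun τ ↦ by simp⟩
  have h := isZeroAtImInfty_halfSlash hr F hp
  have e : halfSlash (m + (r - 1) / 2) (etaTwist r F) 1 (fun _ ↦ 1) = etaTwist r F := by
    funext τ; simp [halfSlash]
  rw [e] at h
  exact h.boundedAtFilter

lemma periodic_etaTwist (r : ℕ) {m : ℤ} (F : ModularForm 𝒮ℒ m) :
    Function.Periodic (etaTwist r F ∘ ofComplex) ((1 : ℝ) : ℂ) := by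
  intro w
  by_cases hw : 0 < w.im
  · have hw' : 0 < (w + (1 : ℝ)).im := by simpa using hw
    simp only [Function.comp_apply, ofComplex_apply_of_im_pos hw, ofComplex_apply_of_im_pos hw',
      ← etaForm_coe]
    have := etaForm_add_natCast r F (24 * w) 24
    rw [show 2 * π * Complex.I * r * (24 : ℕ) / 24 = r * (2 * π * Complex.I) by push_cast; ring,
      Complex.exp_nat_mul_two_pi_mul_I, one_mul] at this
    rw [← this]
    congr 1
    push_cast
    ring
  · have hw' : (w + (1 : ℝ)).im ≤ 0 := by simpa using hw
    simp only [Function.comp_apply, ofComplex_apply_of_im_nonpos (not_lt.mp hw),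
      ofComplex_apply_of_im_nonpos hw']

lemma qParam_one_pow (z : ℂ) (n : ℕ) :
    Function.Periodic.qParam 1 z ^ n = Complex.exp (2 * π * Complex.I * n * (24 * z) / 24) := by
  rw [Function.Periodic.qParam, ← Complex.exp_nat_mul]
  congr 1
  push_cast
  ring

/-- The Fourier coefficients of `η(24τ)^r F(24τ)`. -/
def etaCoeff (r : ℕ) {m : ℤ} (F : ModularForm 𝒮ℒ m) (n : ℕ) : ℂ :=
  (qExpansion 1 (etaTwist r F)).coeff n

lemma hasExpansion_etaForm (hr : Odd r) : HasExpansion (etaForm r F) (etaCoeff r F) := by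
  intro z hz
  have hz24 : 0 < (z / 24).im := by simpa [Complex.div_im] using hz
  have h := UpperHalfPlane.hasSum_qExpansion one_pos (periodic_etaTwist r F)
    (mdifferentiable_etaTwist r F) (isBoundedAtImInfty_etaTwist F hr) ⟨z / 24, hz24⟩
  simp only [smul_eq_mul, qParam_one_pow, ← etaForm_coe] at h
  rwa [show 24 * (z / 24) = z by ring] at h

/-- The shift `z ↦ z + 1` multiplies the function by `exp(2πi r / 24)` and the `n`-th term by
`exp(2πi n / 24)`; uniqueness of coefficients forces the two to agree wherever the coefficient is
nonzero. -/
lemma etaCoeff_eq_zero (hr : Odd r) {n : ℕ} (hn : n % 24 ≠ r % 24) : etaCoeff r F n = 0 := by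
  have hexp := hasExpansion_etaForm F hr
  set u : ℕ → ℂ := fun n ↦ Complex.exp (2 * π * Complex.I * n / 24) with hu
  have huniq : ∀ n, (u r)⁻¹ * (etaCoeff r F n * u n) = etaCoeff r F n := by
    -- The uniqueness lemma is stated for a `FunLike` type; here it is applied to plain functions.
    let : FunLike (ℍ → ℂ) ℍ ℂ := ⟨id, Function.injective_id⟩
    refine UpperHalfPlane.qExpansion_coeff_unique
      (c := fun n ↦ (u r)⁻¹ * (etaCoeff r F n * u n)) (etaTwist r F) one_pos
      (analyticAt_cuspFunction_zero one_pos (periodic_etaTwist r F) (mdifferentiable_etaTwist r F)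
        (isBoundedAtImInfty_etaTwist F hr)) fun τ ↦ ?_
    have h := (hexp (24 * τ + 1) (by simpa using τ.im_pos)).mul_left (u r)⁻¹
    rw [etaForm_add_one, inv_mul_cancel_left₀ (Complex.exp_ne_zero _), etaForm_coe] at h
    refine h.congr_fun fun n ↦ ?_
    rw [smul_eq_mul, qParam_one_pow, hu,
      show 2 * π * Complex.I * n * (24 * τ + 1) / 24 =
        2 * π * Complex.I * n / 24 + 2 * π * Complex.I * n * (24 * τ) / 24 by ring,
      Complex.exp_add]
    ring
  by_contra ha
  have h1 := huniq n
  have h2 : u n = u r := by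
    have := Complex.exp_ne_zero (2 * π * Complex.I * r / 24)
    rw [mul_left_comm, mul_eq_left₀ ha, inv_mul_eq_one₀ this] at h1
    exact h1.symm
  have h3 := Complex.exp_eq_exp_iff_exists_int.mp h2
  obtain ⟨j, hj⟩ := h3
  have hpi : (2 * π * Complex.I : ℂ) ≠ 0 := Complex.two_pi_I_ne_zero
  have h4 : (n : ℂ) = r + 24 * j := by
    have : (2 * π * Complex.I : ℂ) * n = (2 * π * Complex.I) * (r + 24 * j) := by
      linear_combination 24 * hj
    exact mul_left_cancel₀ hpi this
  have h5 : (n : ℤ) = r + 24 * j := by exact_mod_cast h4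
  omega

end HeckeExpansion

/-! ### The Hecke operator as a sum of translates -/

section HeckeTerm

variable {r m : ℕ} (F : ModularForm 𝒮ℒ (m : ℤ)) {ℓ : ℕ} [Fact ℓ.Prime]

variable (r m ℓ) in
/-- The coefficient of the middle term of the Hecke operator as a sum of translates. -/
def heckeMu : ℂ :=
  ((ℓ : ℂ) ^ 2)⁻¹ * primePhase ℓ ^ r * legendreChar ℓ (-1) * (√ℓ : ℝ) ^ (r + 2 * m)

variable (r m ℓ) in
/-- The coefficient of the last term of the Hecke operator as a sum of translates. -/
def heckeNu : ℂ := ((ℓ : ℂ) ^ 2)⁻¹ * (ℓ : ℂ) ^ (r + 2 * m)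

lemma etaInversion_etaForm (hr : Odd r) :
    EtaInversion r m (etaForm r F) (etaCoeff r F) where
  expansion := hasExpansion_etaForm F hr
  inversion _ _ hD _ _ hb _ hσ := etaForm_inversion F r hD hb hσ

/-- The residues modulo `ℓ²` are sorted into 0, `ℓ` times a unit modulo `ℓ`, and units. -/
lemma HasExpansion.sum_translate_sq {f : ℂ → ℂ} {a : ℕ → ℂ} (h : HasExpansion f a)
    [NeZero (ℓ ^ 2)] {z : ℂ} (hz : 0 < z.im) :
    ∑ b : ZMod (ℓ ^ 2), translate f (ℓ ^ 2) z b =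
      f (z / ℓ ^ 2) + unitSum f ℓ 1 (z / ℓ) + unitSum f (ℓ ^ 2) 1 z := by
  have hℓ0 : (ℓ : ℂ) ≠ 0 := NeZero.ne _
  have key : ∀ c : ZMod ℓ, translate f (ℓ ^ 2) z ((ℓ * c.val : ℕ) : ZMod (ℓ ^ 2)) =
      translate f ℓ (z / ℓ) c := by
    intro c
    have := h.translate_intCast (D := ℓ ^ 2) (ℓ * c.val : ℕ) hz
    rw [Int.cast_natCast] at this
    rw [this, translate]
    congr 1
    push_cast
    field_simp
  have h0 : translate f ℓ (z / ℓ) 0 = f (z / ℓ ^ 2) := by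
    rw [translate, ZMod.val_zero]
    congr 1
    push_cast
    field_simp
    ring
  rw [sum_zmod_sq]
  simp_rw [key]
  rw [sum_eq_zero_add_sum_units, h0]
  simp only [unitSum, Pi.one_apply, one_mul]
  ring

lemma chiTwelve576_prime (hℓ : 3 < ℓ) :
    chiTwelve576 (ℓ : ZMod 576) = chiTwelve (ℓ : ZMod 12) := by
  have h : Nat.Coprime ℓ 576 := by
    have := coprime_twelve_prime hℓ
    rw [show 576 = 12 ^ 2 * 2 ^ 2 by norm_num]
    exact (this.symm.pow_right 2).mul_right
      ((Nat.Coprime.coprime_dvd_left (by norm_num) this : Nat.Coprime 2 ℓ).symm.pow_right 2)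
  have := chiTwelve576_intCast (d := ℓ) (Nat.isCoprime_iff_coprime.mpr h)
  simpa using this

/-- Reconciles the coefficient required by inversion with the one in Shimura's formula. The `r`-th
power of the phase and one more Gauss sum make an even power, which reduces by `G² = (-1 / ℓ) ℓ`;
evenness of `m` lets `(-1)^k` depend on `(r - 1) / 2` only. -/
lemma heckeMu_mul (hr : Odd r) (hm : Even m) (hℓ : 3 < ℓ) (n : ℕ) :
    heckeMu r m ℓ * (legendreChar ℓ n * legendreGauss ℓ) =
      chiTwelve576 (ℓ : ZMod 576) *
        (legendreSym ℓ ((-1) ^ (m + (r - 1) / 2) * (n : ℤ)) : ℂ) *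
        (ℓ : ℂ) ^ (((m + (r - 1) / 2 : ℕ) : ℤ) - 1) := by
  have hpos : (0 : ℝ) < ℓ := Nat.cast_pos.mpr (NeZero.pos ℓ)
  have hℓ0 : (ℓ : ℂ) ≠ 0 := NeZero.ne _
  have h1 : legendreChar ℓ (-1) ^ 2 = 1 := legendreChar_sq (neg_ne_zero.mpr one_ne_zero)
  have hG := legendreGauss_sq (ℓ := ℓ) (by omega)
  rw [chiTwelve576_prime hℓ, ← legendreChar_intCast, heckeMu]
  obtain ⟨t, rfl⟩ := hr
  obtain ⟨p, rfl⟩ := hm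
  set s : ℂ := ((√ℓ : ℝ) : ℂ) with hs
  have hs2 : s ^ 2 = ℓ := by
    rw [hs, ← Complex.ofReal_pow, Real.sq_sqrt hpos.le, Complex.ofReal_natCast]
  have hs0 : s ≠ 0 := by rintro h; rw [h] at hs2; simp at hs2; exact hℓ0 hs2.symm
  rw [show p + p + (2 * t + 1 - 1) / 2 = 2 * p + t by omega, pow_succ (primePhase ℓ),
    pow_mul (primePhase ℓ), primePhase_sq hℓ,
    primePhase, zpow_sub₀ hℓ0, zpow_natCast, zpow_one,
    show 2 * t + 1 + 2 * (p + p) = 2 * (t + 2 * p) + 1 by ring, pow_succ s, pow_mul s, hs2]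
  push_cast
  rw [map_mul, map_pow, pow_add _ (2 * p), pow_mul _ 2 p, h1, one_pow, one_mul]
  rw [← hs]
  field_simp
  rw [hG]
  linear_combination (chiTwelve (ℓ : ZMod 12) * legendreChar ℓ (-1) ^ t * (ℓ : ℂ) ^ (t + 2 * p) *
    legendreChar ℓ n * ℓ) * h1

/-- The three terms of the coefficient formula come from averaging over translates modulo `ℓ²`, from
twisting by the Legendre symbol, and from `z ↦ ℓ² z`. -/
lemma hasSum_heckeTerm (hr : Odd r) (hm : Even m) (hℓ : 3 < ℓ) (τ : ℍ) :
    HasSum (heckeTerm (m + (r - 1) / 2) chiTwelve576 ℓ (etaTwist r F) τ)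
      (heckeSum (etaForm r F) ℓ (heckeMu r m ℓ) (heckeNu r m ℓ) (24 * τ)) := by
  have hz : 0 < (24 * (τ : ℂ)).im := by simpa using τ.im_pos
  have hexp := hasExpansion_etaForm F hr
  have : NeZero (ℓ ^ 2) := ⟨pow_ne_zero 2 (NeZero.ne ℓ)⟩
  have h1 := hexp.hasSum_dilate_inv (D := ℓ ^ 2) hz
  have h2 := (hexp.hasSum_legendre (ℓ := ℓ) (by omega) hz).mul_left (heckeMu r m ℓ)
  have h3 := (hexp.hasSum_dilate (D := ℓ ^ 2) hz).mul_left (heckeNu r m ℓ)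
  have hU : ∑ b : ZMod ℓ, legendreChar ℓ b * translate (etaForm r F) ℓ (ℓ * (24 * τ)) b =
      unitSum (etaForm r F) ℓ (legendreChar ℓ) (ℓ * (24 * τ)) := by
    rw [sum_eq_zero_add_sum_units, MulChar.map_zero, zero_mul, zero_add, unitSum]
  rw [hexp.sum_translate_sq hz] at h1
  rw [hU] at h2
  have h := (h1.add h2).add h3
  push_cast at h
  refine h.congr_fun fun n ↦ ?_
  have hν : heckeNu r m ℓ = chiTwelve576 ((ℓ ^ 2 : ℕ) : ZMod 576) *
      (ℓ : ℂ) ^ (2 * ((m + (r - 1) / 2 : ℕ) : ℤ) - 1) := by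
    have hℓ0 : (ℓ : ℂ) ≠ 0 := NeZero.ne _
    rw [Nat.cast_pow, map_pow, chiTwelve576_prime hℓ,
      chiTwelve_sq_of_coprime (coprime_twelve_prime hℓ), one_mul, heckeNu, ← zpow_natCast,
      ← zpow_natCast, ← zpow_neg, ← zpow_add₀ hℓ0]
    congr 1
    obtain ⟨t, rfl⟩ := hr
    rw [show (2 * t + 1 - 1) / 2 = t by omega]
    push_cast
    ring
  rw [heckeTerm, heckeCoeff, qParam_one_pow, ← heckeMu_mul hr hm hℓ, ← hν]
  simp only [etaCoeff]
  ring

end HeckeTerm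

/-! ### Dividing by η^r -/

section HeckeForm

variable {r m : ℕ}

lemma differentiableOn_etaForm (r : ℕ) {m : ℤ} (F : ModularForm 𝒮ℒ m) :
    DifferentiableOn ℂ (etaForm r F) {z | 0 < z.im} :=
  DifferentiableOn.mul
    (fun _ hz ↦ ((differentiableAt_eta_of_mem_upperHalfPlaneSet hz).pow r).differentiableWithinAt)
    (UpperHalfPlane.mdifferentiable_iff.mp F.holo')

lemma differentiableOn_unitSum {f : ℂ → ℂ} (hf : DifferentiableOn ℂ f {z | 0 < z.im}) (D : ℕ)
    [NeZero D] (ψ : ZMod D → ℂ) : DifferentiableOn ℂ (unitSum f D ψ) {z | 0 < z.im} := by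
  refine DifferentiableOn.fun_sum fun u _ ↦ DifferentiableOn.const_mul ?_ _
  refine hf.comp (by fun_prop) fun z hz ↦ ?_
  have := im_add_div_pos (NeZero.ne D) hz (24 * ((u : ZMod D).val : ℝ))
  push_cast at this
  exact this

lemma differentiableOn_heckeSum {f : ℂ → ℂ} (hf : DifferentiableOn ℂ f {z | 0 < z.im}) (ℓ : ℕ)
    [Fact ℓ.Prime] (μ ν : ℂ) : DifferentiableOn ℂ (heckeSum f ℓ μ ν) {z | 0 < z.im} := by
  have hpos : (0 : ℝ) < ℓ := Nat.cast_pos.mpr (NeZero.pos ℓ)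
  have hmul : ∀ z : ℂ, 0 < z.im → 0 < (ℓ * z).im := fun z hz ↦ by simpa using mul_pos hpos hz
  have hdiv : ∀ z : ℂ, 0 < z.im → 0 < (z / ℓ).im := fun z hz ↦ by
    rw [Complex.div_natCast_im]; positivity
  refine (DifferentiableOn.const_mul ((DifferentiableOn.add ?_ ?_).add
    (differentiableOn_unitSum hf _ _)) _).add (DifferentiableOn.const_mul ?_ _) |>.add
    (DifferentiableOn.const_mul ?_ _)
  · refine hf.comp (by fun_prop) fun z hz ↦ ?_
    have := hdiv _ (hdiv z hz)
    rwa [div_div, ← pow_two] at this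
  · exact (differentiableOn_unitSum hf ℓ _).comp (by fun_prop) hdiv
  · exact (differentiableOn_unitSum hf ℓ _).comp (by fun_prop) hmul
  · refine hf.comp (by fun_prop) fun z hz ↦ ?_
    have := hmul _ (hmul z hz)
    rwa [← mul_assoc, ← pow_two] at this

lemma tendsto_tprod_one_sub_eta_q :
    Filter.Tendsto (fun τ : ℍ ↦ ∏' n : ℕ, (1 - eta_q n τ)) atImInfty (nhds 1) := by
  have htprod : Filter.Tendsto (fun q : ℂ ↦ ∏' (n : ℕ), (1 - q ^ (n + 1))) (nhds 0) (nhds 1) := by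
    have := tendsto_tprod_one_add_of_dominated_convergence (𝓕 := nhds 0) (g := 0)
      (f := fun (q : ℂ) (n : ℕ) ↦ -q ^ (n + 1)) (bound := fun n ↦ (1 / 2 : ℝ) ^ (n + 1))
    simp only [Pi.zero_apply, norm_neg, norm_pow, add_zero, tprod_one] at this
    simp_rw [sub_eq_add_neg]
    refine this
      (by simpa only [pow_succ'] using (summable_geometric_of_abs_lt_one (by norm_num)).mul_left _)
      (fun k ↦ by simpa using ((continuous_pow (M := ℂ) (k + 1)).tendsto 0).neg) ?_
    filter_upwards [Metric.ball_mem_nhds (0 : ℂ) (by norm_num : (0 : ℝ) < 1 / 2)] with q hq k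
    exact pow_le_pow_left₀ (norm_nonneg _) (mem_ball_zero_iff.mp hq).le _
  exact htprod.comp (UpperHalfPlane.qParam_tendsto_atImInfty zero_lt_one)

/-- A series `∑ c(n) exp(2πi n z / 24)` supported on `n ≡ r` modulo `24` is `exp(2πi r z / 24)`
times a power series in `exp(2πi z)`. -/
lemma HasExpansion.hasSum_of_support {f : ℂ → ℂ} {c : ℕ → ℂ} (h : HasExpansion f c) (hr : r < 24)
    (hc : ∀ n, n % 24 ≠ r % 24 → c n = 0) {z : ℂ} (hz : 0 < z.im) :
    HasSum (fun j : ℕ ↦ c (24 * j + r) * Function.Periodic.qParam 1 z ^ j)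
      (f z / Function.Periodic.qParam 24 z ^ r) := by
  have hinj : Function.Injective fun j : ℕ ↦ 24 * j + r := fun x y hxy ↦ by
    simp only at hxy; omega
  have h1 := (h z hz).div_const (Function.Periodic.qParam 24 z ^ r)
  rw [← hinj.hasSum_iff] at h1
  · refine h1.congr_fun fun j ↦ ?_
    simp only [Function.comp_apply]
    have h0 : Function.Periodic.qParam 24 z ^ r ≠ 0 := pow_ne_zero _ (Function.Periodic.qParam_ne_zero z)
    rw [eq_div_iff h0, mul_assoc]
    congr 1
    rw [Function.Periodic.qParam, Function.Periodic.qParam, ← Complex.exp_nat_mul,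
      ← Complex.exp_nat_mul, ← Complex.exp_add]
    congr 1
    push_cast
    ring
  · intro n hn
    rw [hc n fun hn' ↦ hn ⟨n / 24, ?_⟩]
    · simp
    · simp only; omega

lemma denom_intCast (γ : SL(2, ℤ)) (τ : ℍ) :
    UpperHalfPlane.denom γ τ = (γ 1 0 : ℂ) * τ + γ 1 1 := by
  simp [UpperHalfPlane.denom]

/-- A holomorphic function with a Fourier expansion like that of `η^r`, and which transforms like
`η^r F` under `z ↦ -1 / z`, is the product of `η^r` and a modular form. -/
theorem exists_modularForm_of_inversion {f : ℂ → ℂ} {c : ℕ → ℂ} (h : HasExpansion f c)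
    (hr : r < 24) (hc : ∀ n, n % 24 ≠ r % 24 → c n = 0)
    (hdiff : DifferentiableOn ℂ f {z | 0 < z.im})
    (hS : ∀ z : ℂ, 0 < z.im → f (-1 / z) = autFactor r m z * f z) :
    ∃ G : ModularForm 𝒮ℒ (m : ℤ), ∀ τ : ℍ, f τ = eta τ ^ r * G τ := by
  have hη : ∀ z : ℂ, 0 < z.im → eta z ^ r ≠ 0 := fun z hz ↦ pow_ne_zero r (eta_ne_zero hz)
  set g : ℍ → ℂ := fun τ ↦ f τ / eta τ ^ r with hg
  have hgT : g ∣[(m : ℤ)] ModularGroup.T = g := by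
    funext τ
    have h1 : f (τ + 1) = Complex.exp (2 * π * Complex.I * r / 24) * f τ := by
      refine (h (τ + 1) (by simpa using τ.im_pos)).unique ?_
      refine ((h τ τ.im_pos).mul_left _).congr_fun fun n ↦ ?_
      by_cases hn : n % 24 = r % 24
      · have hn' : n = 24 * (n / 24) + r := by omega
        rw [show 2 * π * Complex.I * n * (τ + 1) / 24 = 2 * π * Complex.I * r / 24 +
          2 * π * Complex.I * n * τ / 24 + ((n / 24 : ℕ) : ℂ) * (2 * π * Complex.I) by
            have : (n : ℂ) = 24 * ((n / 24 : ℕ) : ℂ) + r := by exact_mod_cast hn'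
            linear_combination (2 * π * Complex.I / 24) * this,
          Complex.exp_add, Complex.exp_add, Complex.exp_nat_mul_two_pi_mul_I]
        ring
      · rw [hc n hn]; ring
    have h2 : ((ModularGroup.T • τ : ℍ) : ℂ) = τ + 1 := by
      rw [UpperHalfPlane.modular_T_smul]; simp [add_comm]
    have h3 : UpperHalfPlane.denom ModularGroup.T τ = 1 := by
      rw [denom_intCast]; simp [ModularGroup.T]
    rw [SL_slash_apply, h3, one_zpow, mul_one]
    simp only [hg, h2, h1]
    rw [eta_add_one, mul_pow, ← Complex.exp_nat_mul,
      show (r : ℂ) * (2 * π * Complex.I / 24) = 2 * π * Complex.I * r / 24 by ring,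
      mul_div_mul_left _ _ (Complex.exp_ne_zero _)]
  have hgS : g ∣[(m : ℤ)] ModularGroup.S = g := by
    funext τ
    have h2 : ((ModularGroup.S • τ : ℍ) : ℂ) = -1 / τ := by
      rw [UpperHalfPlane.modular_S_smul]; simp [inv_neg, neg_div]
    have h3 : UpperHalfPlane.denom ModularGroup.S τ = τ := by
      rw [denom_intCast]; simp [ModularGroup.S]
    have h4 : ((-Complex.I * τ : ℂ) ^ (1 / 2 : ℂ)) ^ r ≠ 0 :=
      pow_ne_zero _ fun hz ↦ neg_I_mul_ne_zero τ.im_pos (Complex.cpow_eq_zero_iff _ _ |>.mp hz).1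
    have h5 := hη τ τ.im_pos
    have h6 := τ.ne_zero
    rw [SL_slash_apply, h3]
    simp only [hg, h2]
    rw [hS τ τ.im_pos, eta_neg_inv τ.im_pos, autFactor, mul_pow, zpow_neg, zpow_natCast]
    field_simp
  have hgSL := SlashInvariantForm.slash_action_generators_SL2Z hgS hgT
  -- As `r < 24`, an exponent congruent to `r` modulo 24 is `24 j + r` with `j ≥ 0`. Hence `f`
  -- divided by the leading factor of `η^r` is a power series in `q`, and the remaining product
  -- tends to 1.
  have hbdd : IsBoundedAtImInfty g := by
    have h1 : IsBoundedAtImInfty fun τ : ℍ ↦ f τ / Function.Periodic.qParam 24 τ ^ r :=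
      isBoundedAtImInfty_of_hasSum_qExpansion one_pos
        fun τ ↦ h.hasSum_of_support hr hc τ.im_pos
    have h2 : IsBoundedAtImInfty fun τ : ℍ ↦ ((∏' n : ℕ, (1 - eta_q n τ)) ^ r)⁻¹ :=
      ((tendsto_tprod_one_sub_eta_q.pow r).inv₀ (by simp)).isBigO_one ℝ
    have h3 : g = (fun τ : ℍ ↦ f τ / Function.Periodic.qParam 24 τ ^ r) *
        fun τ : ℍ ↦ ((∏' n : ℕ, (1 - eta_q n τ)) ^ r)⁻¹ := by
      funext τ
      rw [Pi.mul_apply, ← div_eq_mul_inv, div_div, ← mul_pow]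
      rfl
    rw [h3]
    exact h1.mul h2
  refine ⟨⟨⟨g, ?_⟩, ?_, ?_⟩, fun τ ↦ ?_⟩
  · rintro _ ⟨γ, rfl⟩
    exact hgSL γ
  · rw [UpperHalfPlane.mdifferentiable_iff]
    refine (hdiff.div (fun z hz ↦ ((differentiableAt_eta_of_mem_upperHalfPlaneSet hz).pow
      r).differentiableWithinAt) hη).congr fun z hz ↦ ?_
    simp [hg, ofComplex_apply_of_im_pos hz]
  · intro c hc
    rw [OnePoint.isBoundedAt_iff_forall_SL2Z hc]
    intro γ _
    change IsBoundedAtImInfty (g ∣[(m : ℤ)] γ)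
    rw [hgSL]
    exact hbdd
  · exact (mul_div_cancel₀ _ (hη τ τ.im_pos)).symm

end HeckeForm

/-! ### The eigenform property -/

section Eigenform

variable {r m : ℕ} (F : ModularForm 𝒮ℒ (m : ℤ)) {ℓ : ℕ} [Fact ℓ.Prime]

lemma sq_mod_twentyFour (hℓ : 3 < ℓ) : ℓ ^ 2 % 24 = 1 := by
  have h := coprime_twelve_prime hℓ
  have h24 : Nat.Coprime ℓ 24 :=
    (h.symm.mul_right (Nat.Coprime.coprime_dvd_left (by norm_num) h : Nat.Coprime 2 ℓ).symm :)
  have hu : ∀ x : ZMod 24, IsUnit x → x ^ 2 = 1 := by decide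
  have := hu ℓ ((ZMod.isUnit_iff_coprime ℓ 24).mpr h24)
  have h1 : ((ℓ ^ 2 : ℕ) : ZMod 24) = (1 : ℕ) := by exact_mod_cast this
  exact (ZMod.natCast_eq_natCast_iff' _ _ _).mp h1

/-- As `ℓ² ≡ 1` modulo 24, multiplying or dividing an index by `ℓ²` keeps its class modulo 24. -/
lemma heckeCoeff_eq_zero {k : ℕ} {N : ℕ} (χ : DirichletCharacter ℂ N) (hℓ : 3 < ℓ) {a : ℕ → ℂ}
    (ha : ∀ n, n % 24 ≠ r % 24 → a n = 0) {n : ℕ} (hn : n % 24 ≠ r % 24) :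
    heckeCoeff k χ ℓ a n = 0 := by
  have hsq := sq_mod_twentyFour hℓ
  have h1 : ∀ n, ℓ ^ 2 * n % 24 = n % 24 := fun n ↦ by
    rw [Nat.mul_mod, hsq, one_mul, Nat.mod_mod]
  rw [heckeCoeff, ha n hn, ha (ℓ ^ 2 * n) (by rwa [h1])]
  split_ifs with hd
  · rw [ha (n / ℓ ^ 2) (by rwa [← h1, Nat.mul_div_cancel' hd])]; ring
  · ring

lemma hasExpansion_heckeSum (hr : Odd r) (hm : Even m) (hℓ : 3 < ℓ) :
    HasExpansion (heckeSum (etaForm r F) ℓ (heckeMu r m ℓ) (heckeNu r m ℓ))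
      (heckeCoeff (m + (r - 1) / 2) chiTwelve576 ℓ (etaCoeff r F)) := by
  intro z hz
  have hz24 : 0 < (z / 24).im := by simpa [Complex.div_im] using hz
  have h := hasSum_heckeTerm F hr hm hℓ ⟨z / 24, hz24⟩
  rw [show 24 * (z / 24) = z by ring] at h
  refine h.congr_fun fun n ↦ ?_
  rw [heckeTerm, qParam_one_pow, show 24 * (z / 24) = z by ring]
  rfl

/-- The image under T(ℓ²) is `η^r G` in the variable `z = 24 τ`, with G in the one-dimensional space
spanned by F; the scalar relating G to F is the eigenvalue. -/
theorem exists_heckeT_eq_smul (hr : Odd r) (hr24 : r < 24) (hm : Even m)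
    (hdim : Module.rank ℂ (ModularForm 𝒮ℒ (m : ℤ)) = 1) (hF : F ≠ 0) (hℓ : 3 < ℓ) :
    ∃ c : ℂ, heckeT (m + (r - 1) / 2) chiTwelve576 ℓ (etaTwist r F) = c • etaTwist r F := by
  obtain ⟨G, hG⟩ := exists_modularForm_of_inversion (hasExpansion_heckeSum F hr hm hℓ) hr24
    (fun n ↦ heckeCoeff_eq_zero chiTwelve576 hℓ fun n ↦ etaCoeff_eq_zero F hr)
    (differentiableOn_heckeSum (differentiableOn_etaForm r F) ℓ _ _)
    (fun z hz ↦ (etaInversion_etaForm F hr).heckeSum_neg_inv hr hℓ rfl rfl hz)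
  obtain ⟨c, hc⟩ := (finrank_eq_one_iff_of_nonzero' F hF).mp
    (Module.rank_eq_one_iff_finrank_eq_one.mp hdim) G
  refine ⟨c, funext fun τ ↦ ?_⟩
  have h := hG (dilate 24 τ)
  rw [heckeT, (hasSum_heckeTerm F hr hm hℓ τ).tsum_eq]
  rw [coe_dilate, ← hc] at h
  push_cast at h
  rw [h]
  change eta (24 * (τ : ℂ)) ^ r * (c * F (dilate 24 τ)) =
    c * (eta (24 * (τ : ℂ)) ^ r * F (dilate 24 τ))
  ring

end Eigenform

end HalfIntegral

end

theorem corollary3p2 (r m : ℕ) (hr1 : 1 ≤ r) (hr23 : r ≤ 23) (hr6 : Nat.Coprime r 6)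
    (hm : Even m) (hdim : Module.rank ℂ (ModularForm 𝒮ℒ (m : ℤ)) = 1)
    (F : ModularForm 𝒮ℒ (m : ℤ)) (hF : F ≠ 0) :
    HalfIntegral.IsCuspForm (m + (r - 1) / 2) 576 HalfIntegral.chiTwelve576
        (HalfIntegral.etaTwist r F) ∧
      HalfIntegral.etaTwist r F ≠ 0 ∧
      ∀ (ℓ : ℕ) [Fact ℓ.Prime], 3 < ℓ → ∃ c : ℂ,
        (∀ τ : ℍ, Summable (HalfIntegral.heckeTerm (m + (r - 1) / 2) HalfIntegral.chiTwelve576 ℓ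
          (HalfIntegral.etaTwist r F) τ)) ∧
        HalfIntegral.heckeT (m + (r - 1) / 2) HalfIntegral.chiTwelve576 ℓ
          (HalfIntegral.etaTwist r F) = c • HalfIntegral.etaTwist r F := by
  have hr : Odd r := Nat.coprime_two_right.mp (hr6.coprime_dvd_right (by norm_num))
  refine ⟨HalfIntegral.isCuspForm_etaTwist hr hm F, HalfIntegral.etaTwist_ne_zero r hF, ?_⟩
  intro ℓ _ hℓ
  obtain ⟨c, hc⟩ := HalfIntegral.exists_heckeT_eq_smul F hr (by omega) hm hdim hF hℓ
  exact ⟨c, fun τ ↦ (HalfIntegral.hasSum_heckeTerm F hr hm hℓ τ).summable, hc⟩
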